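/- Let $A_1,\dots,A_c$ be simple undirected graphs (the \emph{atoms}, identified with their adjacency matrices) on a common finite vertex set $[n]$. Assume that the sum graph $H=A_1+\cdots+A_c$ on $[n]$ is connected, and that for every $j$ the graph $\underline{A}_j$, obtained from $A_j$ by deleting its isolated vertices, is nonempty and connected. A \emph{colored cycle} is a pair $(\gamma,j)$ with $j\in[c]$ and $\gamma$ a directed cycle on $[n]$ (a sequence of $\ell(\gamma)\ge 1$ distinct vertices up to rotation; length $2$ is allowed); its weight is $w(\gamma,j)=\prod_{(u,v)}(A_j)_{uv}$, over the arcs $(u,v)$ of $\gamma$. A \emph{trivial heap} is a set $M$ of pairwise vertex-disjoint colored cycles; its length $\ell(M)$ is the sum of the lengths and its weight $w(M)$ the product of the weights of its members. The \emph{additive characteristic polynomial} is \[ \alpha(A_1,\dots,A_c;x)=\sum_{k=0}^n b_k\,x^{n-k},\qquad b_k=\sum_{M:\ \ell(M)=k}(-1)^{|M|}w(M). \] Fix $v_1\in[n]$. The \emph{additive product} $X=A_1\oplus\cdots\oplus A_c$ (written with a small circle on the plus sign) is the simple graph whose vertices are the strings $v_1C_1v_2C_2\cdots C_kv_{k+1}$,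 $k\ge0$, with $v_i\in[n]$, $C_i\in[c]$, $C_i\ne C_{i+1}$ for $1\le i<k$, and $v_i\neq v_{i+1}$ both vertices of $\underline{A}_{C_i}$ for $1\le i\le k$; its edges are the pairs of vertices $\{sCu,\,sCv\}$ with $\{u,v\}$ an edge of $A_C$, and the pairs $\{s,\,sCv\}$ with $\{u,v\}$ an edge of $A_C$, where $u$ is the last vertex of the string $s$. The \emph{spectral radius} of $X$ is $\rho(X)=\limsup_{t\to\infty}\bigl(c^{(t)}_{pq}\bigr)^{1/t}$, where $c^{(t)}_{pq}$ is the number of walks of length $t$ in $X$ from $p$ to $q$ (the value does not depend on the choice of the vertices $p,q$ of $X$, nor on $v_1$). Then every complex root of $\alpha(A_1,\dots,A_c;x)$ is real and lies in the interval $[-\rho(X),\rho(X)]$. This holds for every choice of $v_1$ and of $p,q$. -/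

import Mathlib

namespace XRamanujan

open Polynomial Filter

/-! ### The additive characteristic polynomial of a sequence of matrices -/

/-- A (directed) cycle on `V`: a nonempty sequence of distinct vertices, up to rotation.
Loops (length one) and back-and-forth cycles along an edge (length two) are cycles. -/
abbrev DirCycle (V : Type*) : Type _ :=
  {γ : {s : Cycle V // s.Nodup} // γ.1 ≠ Cycle.nil}

/-- A colored cycle: a cycle together with a color. -/
abbrev ColoredCycle (V ι : Type*) : Type _ := DirCycle V × ι

section charpoly

variable {V ι R : Type*} [Fintype V] [DecidableEq V] [Fintype ι] [DecidableEq ι] [CommRing R]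

/-- The set of vertices of a colored cycle. -/
def ColoredCycle.verts (γ : ColoredCycle V ι) : Finset V := γ.1.1.1.toFinset

/-- The length (number of arcs) of a colored cycle. -/
def ColoredCycle.length (γ : ColoredCycle V ι) : ℕ := γ.1.1.1.length

/-- The successor of a vertex along a colored cycle (for a cycle of length one, the vertex
itself). -/
def ColoredCycle.succ (γ : ColoredCycle V ι) (v : V) : V := γ.1.1.1.formPerm γ.1.1.2 v

/-- The weight of a colored cycle `(γ, j)`: the product of the entries of the matrix `A j` over the
arcs of `γ`. -/
def ColoredCycle.weight (A : ι → Matrix V V R) (γ : ColoredCycle V ι) : R :=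
  ∏ v ∈ γ.verts, A γ.2 v (γ.succ v)

variable (V ι) in
open Classical in
/-- Trivial heaps of colored cycles: sets of pairwise vertex-disjoint colored cycles.  (Cycles of
weight zero are allowed; the heaps that contain one have weight zero.) -/
noncomputable def trivialHeaps : Finset (Finset (ColoredCycle V ι)) :=
  Finset.univ.filter fun M =>
    ∀ γ ∈ M, ∀ δ ∈ M, γ ≠ δ → Disjoint (ColoredCycle.verts γ) (ColoredCycle.verts δ)

/-- The length of a set of colored cycles. -/
def heapLength (M : Finset (ColoredCycle V ι)) : ℕ := ∑ γ ∈ M, ColoredCycle.length γ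

/-- The weight of a set of colored cycles. -/
def heapWeight (A : ι → Matrix V V R) (M : Finset (ColoredCycle V ι)) : R :=
  ∏ γ ∈ M, ColoredCycle.weight A γ

/-- The coefficient `b k`: the sum of `(-1) ^ |M| * w(M)` over the trivial heaps of length `k`. -/
noncomputable def heapCoeff (A : ι → Matrix V V R) (k : ℕ) : R :=
  ∑ M ∈ (trivialHeaps V ι).filter (fun M => heapLength M = k), (-1) ^ M.card * heapWeight A M

/-- The additive characteristic polynomial `∑ k ≤ n, b k * X ^ (n - k)`, where `n = |V|`. -/
noncomputable def additiveCharpoly (A : ι → Matrix V V R) : R[X] :=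
  ∑ k ∈ Finset.range (Fintype.card V + 1), C (heapCoeff A k) * X ^ (Fintype.card V - k)

end charpoly

/-! ### Sum graphs and additive products -/

section product

variable {V ι : Type*}

/-- The simple graph underlying the sum graph `A₁ + ⋯ + A_c` (multiplicities of edges, which are
irrelevant to connectedness, are forgotten). -/
def sumGraph (A : ι → SimpleGraph V) : SimpleGraph V := ⨆ j, A j

/-- A string `v₁ C₁ v₂ C₂ ⋯ v_k C_k v_{k+1}` with fixed first letter `v₁` is stored as the list
`[(C_k, v_{k+1}), …, (C₁, v₂)]`, last letters first.  This is its last vertex `v_{k+1}`. -/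
def lastVertex (v₁ : V) : List (ι × V) → V
  | [] => v₁
  | (_, v) :: _ => v

/-- The strings that are vertices of the additive product: consecutive colors are different, and
`v_i`, `v_{i+1}` are distinct non-isolated vertices of the atom of color `C_i`. -/
def IsString (A : ι → SimpleGraph V) (v₁ : V) : List (ι × V) → Prop
  | [] => True
  | (c, v) :: s => IsString A v₁ s ∧ (∀ p ∈ s.head?, p.1 ≠ c) ∧
      lastVertex v₁ s ∈ (A c).support ∧ v ∈ (A c).support ∧ lastVertex v₁ s ≠ v

/-- The vertices of the additive product rooted at `v₁`. -/
def ProductVertex (A : ι → SimpleGraph V) (v₁ : V) : Type _ :=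
  {s : List (ι × V) // IsString A v₁ s}

/-- `t` is the string `s c v`, where `c` is a color and `{u, v}` is an edge of color `c` for the
last vertex `u` of `s`. -/
def IsExtension (A : ι → SimpleGraph V) (v₁ : V) (s t : List (ι × V)) : Prop :=
  ∃ c v, t = (c, v) :: s ∧ (A c).Adj (lastVertex v₁ s) v

/-- `s = r c u` and `t = r c v` for a common string `r` and an edge `{u, v}` of color `c`. -/
def IsSibling (A : ι → SimpleGraph V) (s t : List (ι × V)) : Prop :=
  ∃ r c u v, s = (c, u) :: r ∧ t = (c, v) :: r ∧ (A c).Adj u v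

/-- The additive product graph of the atoms `A j`, rooted at `v₁`. -/
def additiveProduct (A : ι → SimpleGraph V) (v₁ : V) : SimpleGraph (ProductVertex A v₁) where
  Adj s t := IsSibling A s.1 t.1 ∨ IsExtension A v₁ s.1 t.1 ∨ IsExtension A v₁ t.1 s.1
  symm := ⟨by
    rintro s t (⟨r, c, u, v, hs, ht, h⟩ | h | h)
    · exact Or.inl ⟨r, c, v, u, ht, hs, h.symm⟩
    · exact Or.inr (Or.inr h)
    · exact Or.inr (Or.inl h)⟩
  loopless := ⟨by
    rintro s (⟨r, c, u, v, hs, ht, h⟩ | ⟨c, v, h, -⟩ | ⟨c, v, h, -⟩)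
    · rw [hs] at ht
      simp only [List.cons.injEq, Prod.mk.injEq, true_and, and_true] at ht
      exact h.ne ht
    · exact absurd h (by simp)
    · exact absurd h (by simp)⟩

end product

/-- The number of walks of length `t` from `u` to `v`. -/
noncomputable def walkCount {W : Type*} (G : SimpleGraph W) (u v : W) (t : ℕ) : ℕ :=
  Nat.card {p : G.Walk u v // p.length = t}

/-- The spectral radius of a connected graph of bounded degree, as the exponential growth rate of
the number of walks from `u` to `v` (it does not depend on `u` and `v`). -/
noncomputable def spectralRadius {W : Type*} (G : SimpleGraph W) (u v : W) : ℝ :=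
  limsup (fun t : ℕ => (walkCount G u v t : ℝ) ^ (1 / (t : ℝ))) atTop

end XRamanujan

/-! Let c(T) be the signed weight of the heaps that cover the vertex set T exactly (`cycleCover`),
so that α(z) is the sum of c(T) z^(n-|T|) over all T.

Real roots. For a single color, c(T) is up to sign a principal minor of a Hermitian matrix, and the
multiaffine polynomial with terms c(T) ∏_{v ∉ T} x_v has no zero with all variables in the upper
half plane (`ne_zero_of_pathSum`). Every cycle has one color, so for several colors c is the set
convolution of the single-color functions (`coverSum_add`). Set convolution preserves stability
(`Stable.setConv`): multiply the two polynomials in separate variables, then merge the variables in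
pairs. Setting all variables equal to z excludes roots in the upper half plane, and conjugation
excludes the lower one.

Bound. Put y = 1/z and let h(S) be the heap polynomial in y on the vertex set S (`heapSum`). The
ratio h(S \ u) / h(S) is 1 / (1 - y R), where y R counts decorated first returns to u. These obey a
recursion of the same form as the first-return decomposition of walks in the product X. Comparing
the recursions coefficientwise (`branchBound`) bounds the ratio by the series of closed walks at a
string ending in u (`exists_deletion_series`), which converges for |y| < 1/ρ(X). A zero of h(V) in
that disk would thus remain a zero after each deletion. Deleting the vertices along edges of the
connected sum graph ends at h(∅) = 1, a contradiction. -/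

namespace XRamanujan

open Finset

/-! ### Signed exact covers of vertex sets and their convolution. -/

section polymer

variable {V C R : Type*} [DecidableEq V] [Fintype C] [CommRing R]

open Classical in
/-- The sets of pairwise disjoint polymers that cover exactly `W`. -/
noncomputable def exactCovers (verts : C → Finset V) (W : Finset V) : Finset (Finset C) :=
  Finset.univ.filter fun M =>
    (∀ γ ∈ M, ∀ δ ∈ M, γ ≠ δ → Disjoint (verts γ) (verts δ)) ∧ M.biUnion verts = W

lemma mem_exactCovers {verts : C → Finset V} {W : Finset V} {M : Finset C} :
    M ∈ exactCovers verts W ↔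
      (∀ γ ∈ M, ∀ δ ∈ M, γ ≠ δ → Disjoint (verts γ) (verts δ)) ∧ M.biUnion verts = W := by
  simp [exactCovers]

/-- The signed weight of all exact covers of `W`. -/
noncomputable def coverSum (verts : C → Finset V) (ω : C → R) (W : Finset V) : R :=
  ∑ M ∈ exactCovers verts W, ∏ γ ∈ M, (-ω γ)

/-- The polymers inside `W` that pass through `v`. -/
def through (verts : C → Finset V) (v : V) (W : Finset V) : Finset C :=
  Finset.univ.filter fun γ => v ∈ verts γ ∧ verts γ ⊆ W

lemma mem_through {verts : C → Finset V} {v : V} {W : Finset V} {γ : C} :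
    γ ∈ through verts v W ↔ v ∈ verts γ ∧ verts γ ⊆ W := by
  simp [through]

variable {verts : C → Finset V}

lemma coverSum_empty (hv : ∀ γ, (verts γ).Nonempty) (ω : C → R) :
    coverSum verts ω ∅ = 1 := by
  have : exactCovers verts ∅ = {∅} := by
    ext M
    rw [mem_exactCovers, mem_singleton]
    constructor
    · rintro ⟨-, h⟩
      rw [Finset.eq_empty_iff_forall_notMem]
      intro γ hγ
      obtain ⟨x, hx⟩ := hv γ
      have : x ∈ M.biUnion verts := mem_biUnion.2 ⟨γ, hγ, hx⟩
      simp [h] at this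
    · rintro rfl
      simp
  simp [coverSum, this]

/-- Exactly one polymer of an exact cover contains `v`; removing it leaves an exact cover of the
remaining vertices. -/
lemma coverSum_eq_sum_through (hv : ∀ γ, (verts γ).Nonempty) (ω : C → R) {W : Finset V} {v : V}
    (hvW : v ∈ W) :
    coverSum verts ω W =
      -∑ γ ∈ through verts v W, ω γ * coverSum verts ω (W \ verts γ) := by
  classical
  have key : ∀ γ, ∀ M ∈ exactCovers verts (W \ verts γ), γ ∉ M := by
    intro γ M hM hγ
    rw [mem_exactCovers] at hM
    obtain ⟨x, hx⟩ := hv γ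
    have : x ∈ M.biUnion verts := mem_biUnion.2 ⟨γ, hγ, hx⟩
    rw [hM.2] at this
    exact (mem_sdiff.1 this).2 hx
  simp only [coverSum, mul_sum, ← sum_neg_distrib, ← neg_mul]
  rw [sum_sigma']
  symm
  refine sum_bij (fun p _ => insert p.1 p.2) ?_ ?_ ?_ ?_
  · rintro ⟨γ, M⟩ h
    simp only [mem_sigma, mem_through, mem_exactCovers] at h ⊢
    obtain ⟨⟨h1, h2⟩, h3, h4⟩ := h
    have h5 : ∀ δ ∈ M, Disjoint (verts γ) (verts δ) := by
      intro δ hδ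
      have : verts δ ⊆ W \ verts γ := h4 ▸ subset_biUnion_of_mem verts hδ
      exact (disjoint_of_subset_left this sdiff_disjoint).symm
    refine ⟨?_, ?_⟩
    · intro a ha b hb hab
      rw [mem_insert] at ha hb
      rcases ha with rfl | ha <;> rcases hb with rfl | hb
      · exact absurd rfl hab
      · exact h5 b hb
      · exact (h5 a ha).symm
      · exact h3 a ha b hb hab
    · rw [biUnion_insert, h4, union_sdiff_of_subset h2]
  · rintro ⟨γ, M⟩ h ⟨γ', M'⟩ h' heq
    simp only [mem_sigma, mem_through] at h h' heq
    have hnot : ∀ {γ M}, M ∈ exactCovers verts (W \ verts γ) → v ∈ verts γ →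
        ∀ δ ∈ M, v ∉ verts δ := by
      intro γ M hM hvγ δ hδ hvδ
      have : v ∈ M.biUnion verts := mem_biUnion.2 ⟨δ, hδ, hvδ⟩
      rw [(mem_exactCovers.1 hM).2] at this
      exact (mem_sdiff.1 this).2 hvγ
    have hγ : γ = γ' := by
      have h1 : γ ∈ insert γ' M' := heq ▸ mem_insert_self γ M
      rcases mem_insert.1 h1 with h1 | h1
      · exact h1
      · exact absurd h.1.1 (hnot h'.2 h'.1.1 γ h1)
    subst hγ
    have : M = M' := by
      rw [← erase_insert (key γ M h.2), ← erase_insert (key γ M' h'.2), heq]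
    rw [this]
  · intro M hM
    have hM' := mem_exactCovers.1 hM
    have hv' : v ∈ M.biUnion verts := hM'.2 ▸ hvW
    obtain ⟨γ, hγ, hvγ⟩ := mem_biUnion.1 hv'
    refine ⟨⟨γ, M.erase γ⟩, ?_, insert_erase hγ⟩
    simp only [mem_sigma, mem_through, mem_exactCovers]
    refine ⟨⟨hvγ, hM'.2 ▸ subset_biUnion_of_mem verts hγ⟩, fun a ha b hb hab =>
      hM'.1 a (mem_of_mem_erase ha) b (mem_of_mem_erase hb) hab, ?_⟩
    ext x
    simp only [mem_biUnion, mem_erase, mem_sdiff, ← hM'.2]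
    constructor
    · rintro ⟨δ, ⟨h1, h2⟩, h3⟩
      exact ⟨⟨δ, h2, h3⟩, fun h => disjoint_left.1 (hM'.1 δ h2 γ hγ h1) h3 h⟩
    · rintro ⟨⟨δ, h2, h3⟩, h⟩
      exact ⟨δ, ⟨fun h' => h (h' ▸ h3), h2⟩, h3⟩
  · rintro ⟨γ, M⟩ h
    simp only [mem_sigma] at h
    rw [prod_insert (key γ M h.2)]

/-- The convolution of two functions on finite sets. -/
def setConv (f g : Finset V → R) (W : Finset V) : R := ∑ T ∈ W.powerset, f T * g (W \ T)

/-- Expanding the product over a cover assigns each polymer to `ω` or to `ω'`, and `T` is the part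
covered by the polymers assigned to `ω`. The induction peels off the polymer through a chosen vertex
`v`. -/
lemma coverSum_add (hv : ∀ γ, (verts γ).Nonempty) (ω ω' : C → R) (W : Finset V) :
    coverSum verts (ω + ω') W = setConv (coverSum verts ω) (coverSum verts ω') W := by
  classical
  induction W using Finset.strongInduction with
  | H W ih =>
    rcases W.eq_empty_or_nonempty with rfl | ⟨v, hvW⟩
    · simp [setConv, coverSum_empty hv]
    rw [coverSum_eq_sum_through hv _ hvW]
    have hlt : ∀ γ ∈ through verts v W, W \ verts γ ⊂ W := by
      intro γ hγ
      rw [mem_through] at hγ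
      exact sdiff_ssubset hγ.2 (hv γ)
    -- Here the polymer through `v` carries the weight `ω`; in `h2` it carries `ω'`.
    have h1 : ∑ T ∈ W.powerset with v ∈ T, coverSum verts ω T * coverSum verts ω' (W \ T) =
        -∑ γ ∈ through verts v W, ω γ *
          setConv (coverSum verts ω) (coverSum verts ω') (W \ verts γ) := by
      simp only [setConv, mul_sum]
      rw [sum_congr rfl (g := fun T => -∑ γ ∈ through verts v T,
        ω γ * coverSum verts ω (T \ verts γ) * coverSum verts ω' (W \ T))]
      · rw [sum_neg_distrib, sum_sigma', sum_sigma']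
        congr 1
        refine sum_bij' (fun p _ => ⟨p.2, p.1 \ verts p.2⟩) (fun p _ => ⟨p.2 ∪ verts p.1, p.1⟩)
          ?_ ?_ ?_ ?_ ?_
        · rintro ⟨T, γ⟩ h
          simp only [mem_sigma, mem_filter, mem_powerset, mem_through] at h ⊢
          exact ⟨⟨h.2.1, h.2.2.trans h.1.1⟩, sdiff_subset_sdiff h.1.1 le_rfl⟩
        · rintro ⟨γ, T⟩ h
          simp only [mem_sigma, mem_filter, mem_powerset, mem_through] at h ⊢
          exact ⟨⟨union_subset (h.2.trans sdiff_subset) h.1.2, mem_union_right _ h.1.1⟩,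
            h.1.1, subset_union_right⟩
        · rintro ⟨T, γ⟩ h
          simp only [mem_sigma, mem_filter, mem_powerset, mem_through] at h ⊢
          simp [sdiff_union_of_subset h.2.2]
        · rintro ⟨γ, T⟩ h
          simp only [mem_sigma, mem_powerset, mem_through] at h ⊢
          have : Disjoint T (verts γ) := disjoint_of_subset_left h.2 sdiff_disjoint
          simp [union_sdiff_cancel_right this]
        · rintro ⟨T, γ⟩ h
          simp only [mem_sigma, mem_through] at h ⊢
          have : (W \ verts γ) \ (T \ verts γ) = W \ T := by
            ext x
            have := @h.2.2 x
            simp only [mem_sdiff]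
            tauto
          rw [this, mul_assoc]
      · intro T hT
        rw [coverSum_eq_sum_through hv ω (mem_filter.1 hT).2, neg_mul, sum_mul]
    have h2 : ∑ T ∈ W.powerset with v ∉ T, coverSum verts ω T * coverSum verts ω' (W \ T) =
        -∑ γ ∈ through verts v W, ω' γ *
          setConv (coverSum verts ω) (coverSum verts ω') (W \ verts γ) := by
      simp only [setConv, mul_sum]
      rw [sum_congr rfl (g := fun T => -∑ γ ∈ through verts v (W \ T),
        ω' γ * (coverSum verts ω T * coverSum verts ω' ((W \ T) \ verts γ)))]
      · rw [sum_neg_distrib, sum_sigma', sum_sigma']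
        congr 1
        refine sum_bij' (fun p _ => ⟨p.2, p.1⟩) (fun p _ => ⟨p.2, p.1⟩) ?_ ?_ ?_ ?_ ?_
        · rintro ⟨T, γ⟩ h
          simp only [mem_sigma, mem_filter, mem_powerset, mem_through] at h ⊢
          refine ⟨⟨h.2.1, h.2.2.trans sdiff_subset⟩, subset_sdiff.2 ⟨h.1.1, ?_⟩⟩
          exact (disjoint_of_subset_left h.2.2 sdiff_disjoint).symm
        · rintro ⟨γ, T⟩ h
          simp only [mem_sigma, mem_filter, mem_powerset, mem_through, subset_sdiff] at h ⊢
          exact ⟨⟨h.2.1, fun hvT => disjoint_left.1 h.2.2 hvT h.1.1⟩, h.1.1, h.1.2, h.2.2.symm⟩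
        · rintro ⟨T, γ⟩ h; rfl
        · rintro ⟨γ, T⟩ h; rfl
        · rintro ⟨T, γ⟩ h
          rw [sdiff_sdiff_comm]
      · intro T hT
        simp only [mem_filter, mem_powerset] at hT
        rw [coverSum_eq_sum_through hv ω' (mem_sdiff.2 ⟨hvW, hT.2⟩), mul_neg, mul_sum]
        congr 1
        exact sum_congr rfl fun γ _ => by ring
    rw [setConv, ← sum_filter_add_sum_filter_not W.powerset (fun T => v ∈ T), h1, h2, ← neg_add,
      ← sum_add_distrib]
    congr 1
    refine sum_congr rfl fun γ hγ => ?_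
    rw [ih _ (hlt γ hγ), Pi.add_apply]
    ring

/-- The multiaffine polynomial with coefficients `f`, restricted to `S` and evaluated at `x`. -/
def affinePoly (f : Finset V → R) (x : V → R) (S : Finset V) : R :=
  ∑ T ∈ S.powerset, f T * ∏ v ∈ S \ T, x v

lemma affinePoly_empty (f : Finset V → R) (x : V → R) : affinePoly f x ∅ = f ∅ := by
  simp [affinePoly]

lemma affinePoly_eq_add (f : Finset V → R) (x : V → R) {S : Finset V} {v : V} (hv : v ∈ S) :
    affinePoly f x S = x v * affinePoly f x (S.erase v) +
      ∑ T ∈ S.powerset with v ∈ T, f T * ∏ u ∈ S \ T, x u := by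
  rw [affinePoly, ← sum_filter_add_sum_filter_not _ (fun T => v ∈ T), add_comm]
  congr 1
  rw [affinePoly, mul_sum]
  have : S.powerset.filter (fun T => v ∉ T) = (S.erase v).powerset := by
    ext T
    simp only [mem_filter, mem_powerset, subset_erase]
  rw [this]
  refine sum_congr rfl fun T hT => ?_
  rw [mem_powerset, subset_erase] at hT
  rw [erase_sdiff_comm, ← mul_prod_erase (S \ T) x (mem_sdiff.2 ⟨hv, hT.2⟩)]
  ring

/-- Either `v` is left uncovered and contributes `x v`, or it lies on a unique polymer, which is
removed. -/
lemma affinePoly_coverSum (hv : ∀ γ, (verts γ).Nonempty) (ω : C → R) (x : V → R) {S : Finset V}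
    {v : V} (hvS : v ∈ S) :
    affinePoly (coverSum verts ω) x S = x v * affinePoly (coverSum verts ω) x (S.erase v) -
      ∑ γ ∈ through verts v S, ω γ * affinePoly (coverSum verts ω) x (S \ verts γ) := by
  classical
  rw [affinePoly_eq_add _ _ hvS, sub_eq_add_neg]
  congr 1
  simp only [affinePoly, mul_sum]
  rw [sum_congr rfl (g := fun T => -∑ γ ∈ through verts v T,
        ω γ * coverSum verts ω (T \ verts γ) * ∏ u ∈ S \ T, x u)]
  · rw [sum_neg_distrib, sum_sigma', sum_sigma']
    congr 1
    refine sum_bij' (fun p _ => ⟨p.2, p.1 \ verts p.2⟩) (fun p _ => ⟨p.2 ∪ verts p.1, p.1⟩)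
      ?_ ?_ ?_ ?_ ?_
    · rintro ⟨T, γ⟩ h
      simp only [mem_sigma, mem_filter, mem_powerset, mem_through] at h ⊢
      exact ⟨⟨h.2.1, h.2.2.trans h.1.1⟩, sdiff_subset_sdiff h.1.1 le_rfl⟩
    · rintro ⟨γ, T⟩ h
      simp only [mem_sigma, mem_filter, mem_powerset, mem_through] at h ⊢
      exact ⟨⟨union_subset (h.2.trans sdiff_subset) h.1.2, mem_union_right _ h.1.1⟩,
        h.1.1, subset_union_right⟩
    · rintro ⟨T, γ⟩ h
      simp only [mem_sigma, mem_filter, mem_powerset, mem_through] at h ⊢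
      simp [sdiff_union_of_subset h.2.2]
    · rintro ⟨γ, T⟩ h
      simp only [mem_sigma, mem_powerset, mem_through] at h ⊢
      have : Disjoint T (verts γ) := disjoint_of_subset_left h.2 sdiff_disjoint
      simp [union_sdiff_cancel_right this]
    · rintro ⟨T, γ⟩ h
      simp only [mem_sigma, mem_through] at h ⊢
      have : (S \ verts γ) \ (T \ verts γ) = S \ T := by
        ext x
        have := @h.2.2 x
        simp only [mem_sdiff]
        tauto
      rw [this, mul_assoc]
  · intro T hT
    rw [coverSum_eq_sum_through hv ω (mem_filter.1 hT).2, neg_mul, sum_mul]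

end polymer

end XRamanujan

namespace XRamanujan

open Finset

/-! ### Weighted self-avoiding paths. -/

section paths

variable {V R : Type*} [Fintype V] [DecidableEq V] [CommRing R]

/-- The lists of distinct elements of `S`. -/
def nodupLists (S : Finset V) : Finset (List V) :=
  ((Finset.univ : Finset {l : List V // l.Nodup}).map (Function.Embedding.subtype _)).filter
    fun l => l.toFinset ⊆ S

lemma mem_nodupLists {S : Finset V} {l : List V} :
    l ∈ nodupLists S ↔ l.Nodup ∧ l.toFinset ⊆ S := by
  simp [nodupLists]

lemma sum_nodupLists (S : Finset V) (g : List V → R) :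
    ∑ l ∈ nodupLists S, g l = g [] + ∑ u ∈ S, ∑ l ∈ nodupLists (S.erase u), g (u :: l) := by
  have h : nodupLists S =
      insert [] (S.biUnion fun u => (nodupLists (S.erase u)).image (List.cons u)) := by
    ext l
    simp only [mem_insert, mem_biUnion, mem_image, mem_nodupLists]
    cases l with
    | nil => simp
    | cons u l =>
      simp only [List.nodup_cons, List.toFinset_cons, insert_subset_iff, reduceCtorEq,
        List.cons.injEq, false_or, subset_erase, List.mem_toFinset]
      constructor
      · rintro ⟨⟨h1, h2⟩, h3, h4⟩
        exact ⟨u, h3, l, ⟨h2, h4, h1⟩, rfl, rfl⟩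
      · rintro ⟨_, h3, _, ⟨h2, h4, h1⟩, rfl, rfl⟩
        exact ⟨⟨h1, h2⟩, h3, h4⟩
  rw [h, sum_insert (by simp), sum_biUnion]
  · congr 1
    refine sum_congr rfl fun u _ => ?_
    rw [sum_image]
    intro a _ b _ hab
    exact List.cons_injective hab
  · intro u _ u' _ huu'
    simp only [Function.onFun, disjoint_left, mem_image]
    rintro _ ⟨l, -, rfl⟩ ⟨l', -, h⟩
    exact huu' (List.cons.inj h).1.symm

/-- The weight of the path that starts at `u`, visits the vertices of a list and ends at `t`. -/
def pathWeight (a : Matrix V V R) : V → List V → V → R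
  | u, [], t => a u t
  | u, u' :: l, t => a u u' * pathWeight a u' l t

/-- The sum over the self-avoiding paths in `S` that start at `u` and then step to `t`, weighted by
the value of `φ` on the complement of the path. -/
def pathSum (a : Matrix V V R) (φ : Finset V → R) (S : Finset V) (u t : V) : R :=
  ∑ l ∈ nodupLists (S.erase u), pathWeight a u l t * φ (S.erase u \ l.toFinset)

/-- Split at the first step. The start `u` leaves the available set at once, so `t = u` is allowed
and gives closed paths. -/
lemma pathSum_eq (a : Matrix V V R) (φ : Finset V → R) (S : Finset V) (u t : V) :
    pathSum a φ S u t = a u t * φ (S.erase u) +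
      ∑ u' ∈ S.erase u, a u u' * pathSum a φ (S.erase u) u' t := by
  rw [pathSum, sum_nodupLists]
  simp only [pathWeight, List.toFinset_nil, sdiff_empty, pathSum, mul_sum]
  congr 1
  refine sum_congr rfl fun u' _ => sum_congr rfl fun l _ => ?_
  rw [mul_assoc, List.toFinset_cons]
  congr 3
  ext x
  simp only [mem_sdiff, mem_insert, mem_erase]
  tauto

omit [Fintype V] [DecidableEq V] in
lemma prod_map_eq_pathWeight (a : Matrix V V R) (σ : V → V) (t : V) :
    ∀ (l : List V) (u : V), (u :: l).IsChain (fun p q => σ p = q) →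
      σ ((u :: l).getLast (List.cons_ne_nil u l)) = t →
      ((u :: l).map fun w => a w (σ w)).prod = pathWeight a u l t
  | [], u, _, h => by simpa [pathWeight] using congrArg (a u) h
  | u' :: l, u, hc, h => by
    rw [List.isChain_cons_cons] at hc
    rw [List.map_cons, List.prod_cons, prod_map_eq_pathWeight a σ t l u' hc.2 (by simpa using h),
      hc.1, pathWeight]

omit [Fintype V] in
lemma prod_formPerm_eq_pathWeight (a : Matrix V V R) (v : V) (l : List V) (h : (v :: l).Nodup) :
    ∏ w ∈ (v :: l).toFinset, a w ((v :: l).formPerm w) = pathWeight a v l v := by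
  rw [List.prod_toFinset _ h]
  refine prod_map_eq_pathWeight a _ v l v ?_ (List.formPerm_apply_getLast v l)
  rw [List.isChain_iff_getElem]
  intro i hi
  exact List.formPerm_apply_lt_getElem _ h i hi

end paths

/-! ### Colored cycles as closed self-avoiding paths. -/

section cycles

variable {V ι R : Type*} [Fintype V] [DecidableEq V] [Fintype ι] [CommRing R]

omit [Fintype V] [Fintype ι] in
lemma ColoredCycle.verts_nonempty (γ : ColoredCycle V ι) : γ.verts.Nonempty := by
  rw [Finset.nonempty_iff_ne_empty, Ne, ColoredCycle.verts, Cycle.toFinset_eq_nil]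
  exact γ.1.2

omit [Fintype V] [Fintype ι] in
lemma ColoredCycle.card_verts (γ : ColoredCycle V ι) : γ.verts.card = γ.length := by
  obtain ⟨⟨⟨s, hs⟩, h⟩, j⟩ := γ
  induction s using Quotient.inductionOn' with
  | h l =>
    exact List.toFinset_card_of_nodup hs

/-- The cycle that visits `v` and then the vertices of `l`. -/
def cycleThrough (v : V) (l : List V) (h : (v :: l).Nodup) : DirCycle V :=
  ⟨⟨((v :: l : List V) : Cycle V), Cycle.nodup_coe_iff.2 h⟩, fun h' =>
    List.cons_ne_nil v l ((Cycle.coe_eq_nil _).1 h')⟩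

omit [Fintype V] [Fintype ι] in
lemma verts_cycleThrough {v : V} {l : List V} (h : (v :: l).Nodup) (j : ι) :
    ColoredCycle.verts (cycleThrough v l h, j) = (v :: l).toFinset := rfl

omit [Fintype V] [Fintype ι] in
lemma weight_cycleThrough (A : ι → Matrix V V R) {v : V} {l : List V} (h : (v :: l).Nodup)
    (j : ι) : ColoredCycle.weight A (cycleThrough v l h, j) = pathWeight (A j) v l v :=
  prod_formPerm_eq_pathWeight (A j) v l h

omit [Fintype V] [DecidableEq V] in
-- A rotation of a duplicate-free list that keeps the first entry is trivial, so a base vertex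
-- removes the ambiguity of cycles up to rotation.
lemma cycleThrough_injective {v : V} {l l' : List V} {h : (v :: l).Nodup} {h' : (v :: l').Nodup}
    (heq : cycleThrough v l h = cycleThrough v l' h') : l = l' := by
  have hr : (v :: l) ~r (v :: l') :=
    Cycle.coe_eq_coe.1 (congrArg (fun c : DirCycle V => c.1.1) heq)
  obtain ⟨n, hn⟩ := hr
  have h0 := congrArg List.head? hn
  rw [← List.rotate_mod] at h0
  have hlt : n % (v :: l).length < (v :: l).length := Nat.mod_lt _ (by simp)
  rw [List.head?_rotate hlt, List.getElem?_eq_getElem hlt, List.head?_cons, Option.some_inj] at h0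
  have h1 : n % (v :: l).length = 0 :=
    (h.getElem_inj_iff (hi := hlt) (hj := by simp)).1 (by simpa using h0)
  rw [← List.rotate_mod, h1, List.rotate_zero] at hn
  exact (List.cons.inj hn).2

omit [Fintype V] in
lemma exists_cycleThrough (γ : DirCycle V) {v : V} (hv : v ∈ γ.1.1.toFinset) :
    ∃ (l : List V) (h : (v :: l).Nodup), cycleThrough v l h = γ := by
  obtain ⟨⟨s, hs⟩, hγ⟩ := γ
  induction s using Quotient.inductionOn' with
  | h l =>
    have hl : l.Nodup := hs
    have hvl : v ∈ l := List.mem_toFinset.1 hv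
    obtain ⟨l₁, l₂, rfl⟩ := List.append_of_mem hvl
    have hrot : (l₁ ++ v :: l₂) ~r (v :: (l₂ ++ l₁)) := List.isRotated_append
    exact ⟨l₂ ++ l₁, hrot.nodup_iff.1 hl,
      Subtype.ext (Subtype.ext (Cycle.coe_eq_coe.2 hrot.symm))⟩

lemma sum_through (A : ι → Matrix V V R) (φ : Finset V → R) {S : Finset V} {v : V} (hv : v ∈ S) :
    ∑ γ ∈ through (ColoredCycle.verts (V := V) (ι := ι)) v S, γ.weight A * φ (S \ γ.verts) =
      ∑ j, pathSum (A j) φ S v v := by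
  simp only [pathSum]
  rw [← sum_product' (s := univ) (t := nodupLists (S.erase v))
    (f := fun j l => pathWeight (A j) v l v * φ (S.erase v \ l.toFinset))]
  symm
  have hmem : ∀ p ∈ (univ : Finset ι) ×ˢ nodupLists (S.erase v), (v :: p.2).Nodup := by
    intro p hp
    rw [mem_product, mem_nodupLists] at hp
    exact List.nodup_cons.2 ⟨fun h => notMem_erase v S (hp.2.2 (List.mem_toFinset.2 h)), hp.2.1⟩
  refine sum_bij (fun p hp => (cycleThrough v p.2 (hmem p hp), p.1)) ?_ ?_ ?_ ?_
  · intro p hp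
    rw [mem_through, verts_cycleThrough, List.toFinset_cons]
    rw [mem_product, mem_nodupLists] at hp
    exact ⟨mem_insert_self _ _, insert_subset hv (hp.2.2.trans (erase_subset _ _))⟩
  · rintro ⟨j, l⟩ hp ⟨j', l'⟩ hp' h
    exact Prod.ext (congrArg Prod.snd h) 
      (cycleThrough_injective (h := hmem _ hp) (h' := hmem _ hp') (congrArg Prod.fst h))
  · rintro ⟨γ, j⟩ hγ
    rw [mem_through] at hγ
    obtain ⟨l, h, rfl⟩ := exists_cycleThrough γ hγ.1
    rw [verts_cycleThrough, List.toFinset_cons] at hγ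
    refine ⟨(j, l), ?_, rfl⟩
    rw [mem_product, mem_nodupLists]
    refine ⟨mem_univ _, (List.nodup_cons.1 h).2, fun x hx => mem_erase.2 ⟨?_, ?_⟩⟩
    · rintro rfl
      exact (List.nodup_cons.1 h).1 (List.mem_toFinset.1 hx)
    · exact hγ.2 (mem_insert_of_mem hx)
  · intro p hp
    rw [weight_cycleThrough, verts_cycleThrough]
    congr 2
    ext x
    simp only [mem_sdiff, mem_erase, List.toFinset_cons, mem_insert]
    tauto

/-- The signed count of the colored cycle covers of a vertex set. -/
noncomputable def cycleCover (A : ι → Matrix V V R) : Finset V → R :=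
  coverSum ColoredCycle.verts (ColoredCycle.weight A)

lemma cycleCover_empty (A : ι → Matrix V V R) : cycleCover A ∅ = 1 :=
  coverSum_empty ColoredCycle.verts_nonempty _

/-- Deleting the vertex `v` expresses the heap polynomial through closed self-avoiding paths. -/
lemma affinePoly_cycleCover (A : ι → Matrix V V R) (x : V → R) {S : Finset V} {v : V} (hv : v ∈ S) :
    affinePoly (cycleCover A) x S = x v * affinePoly (cycleCover A) x (S.erase v) -
      ∑ j, pathSum (A j) (affinePoly (cycleCover A) x) S v v := by
  rw [cycleCover, affinePoly_coverSum ColoredCycle.verts_nonempty _ _ hv]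
  congr 1
  exact sum_through A _ hv

/-- Group the heaps by the set they cover: disjointness makes the length of a heap the size of that
set, so the exponent counts uncovered vertices. -/
lemma eval_additiveCharpoly [DecidableEq ι] (A : ι → Matrix V V R) (z : R) :
    (additiveCharpoly A).eval z = affinePoly (cycleCover A) (fun _ => z) univ := by
  classical
  have hcard : ∀ M ∈ trivialHeaps V ι, heapLength M = (M.biUnion ColoredCycle.verts).card := by
    intro M hM
    rw [trivialHeaps, mem_filter] at hM
    rw [card_biUnion hM.2, heapLength]
    exact sum_congr rfl fun γ _ => γ.card_verts.symm
  have h1 : (additiveCharpoly A).eval z = ∑ M ∈ trivialHeaps V ι,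
      (-1) ^ M.card * heapWeight A M * z ^ (Fintype.card V - heapLength M) := by
    simp only [additiveCharpoly, heapCoeff, Polynomial.eval_finsetSum, Polynomial.eval_mul,
      Polynomial.eval_C, Polynomial.eval_pow, Polynomial.eval_X]
    rw [← sum_fiberwise_of_maps_to (s := trivialHeaps V ι) (t := range (Fintype.card V + 1))
      (g := heapLength)]
    · refine sum_congr rfl fun k _ => ?_
      rw [sum_mul]
      exact sum_congr rfl fun M hM => by rw [(mem_filter.1 hM).2]
    · intro M hM
      rw [mem_range, hcard M hM]
      exact Nat.lt_succ_of_le (card_le_univ _)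
  rw [h1, affinePoly, ← sum_fiberwise_of_maps_to (s := trivialHeaps V ι)
    (t := (univ : Finset V).powerset) (g := fun M => M.biUnion ColoredCycle.verts)
    (fun M _ => mem_powerset.2 (subset_univ _))]
  refine sum_congr rfl fun T _ => ?_
  rw [cycleCover, coverSum, sum_mul]
  refine sum_congr ?_ fun M hM => ?_
  · ext M
    rw [mem_exactCovers, mem_filter, trivialHeaps, mem_filter]
    simp
  · rw [mem_exactCovers] at hM
    rw [hcard M (by simpa [trivialHeaps] using hM.1), hM.2, prod_neg, heapWeight, prod_const,
      card_univ_sdiff]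

end cycles

end XRamanujan

namespace XRamanujan

open Finset

/-! ### Stability is preserved by set convolution. -/

section merge

variable {V : Type*} [DecidableEq V]

lemma affinePoly_congr {R : Type*} [CommRing R] {f g : Finset V → R} {x y : V → R} {S : Finset V}
    (hf : ∀ T ⊆ S, f T = g T) (hx : ∀ v ∈ S, x v = y v) : affinePoly f x S = affinePoly g y S := by
  refine sum_congr rfl fun T hT => ?_
  rw [hf T (mem_powerset.1 hT), prod_congr rfl fun v hv => hx v (sdiff_subset hv)]

/-- The coefficients of the multiaffine polynomial obtained by setting the variable `v` to zero. -/
def shift {R : Type*} (f : Finset V → R) (v : V) : Finset V → R := fun T => f (insert v T)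

lemma shift_comm {R : Type*} (f : Finset V → R) (u v : V) :
    shift (shift f u) v = shift (shift f v) u := by
  funext T
  simp only [shift, insert_comm]

lemma affinePoly_insert {R : Type*} [CommRing R] (f : Finset V → R) (x : V → R) {S : Finset V}
    {v : V} (hv : v ∉ S) :
    affinePoly f x (insert v S) = x v * affinePoly f x S + affinePoly (shift f v) x S := by
  rw [affinePoly, sum_powerset_insert hv, affinePoly, affinePoly, mul_sum]
  congr 1
  · refine sum_congr rfl fun T hT => ?_
    have hvT : v ∉ T := fun h => hv (mem_powerset.1 hT h)
    rw [insert_sdiff_of_notMem _ hvT, prod_insert (by simp [hv])]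
    ring
  · refine sum_congr rfl fun T hT => ?_
    have : insert v S \ insert v T = S \ T := by
      ext w
      simp only [mem_sdiff, mem_insert]
      constructor
      · tauto
      · rintro ⟨h1, h2⟩
        refine ⟨Or.inr h1, ?_⟩
        rintro (rfl | h3)
        · exact hv h1
        · exact h2 h3
    rw [this, shift]

lemma shift_setConv {R : Type*} [CommRing R] (f g : Finset V → R) {v : V} {T : Finset V}
    (hv : v ∉ T) :
    shift (setConv f g) v T = setConv (shift f v) g T + setConv f (shift g v) T := by
  rw [shift, setConv, sum_powerset_insert hv, add_comm]
  congr 1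
  · refine sum_congr rfl fun U hU => ?_
    congr 2
    ext w
    simp only [mem_sdiff, mem_insert]
    constructor
    · tauto
    · rintro ⟨h1, h2⟩
      refine ⟨Or.inr h1, ?_⟩
      rintro (rfl | h3)
      · exact hv h1
      · exact h2 h3
  · refine sum_congr rfl fun U hU => ?_
    rw [insert_sdiff_of_notMem _ fun h => hv (mem_powerset.1 hU h), shift]

/-- The product of two multiaffine polynomials in separate variables, after the variables of the
vertices in the list `K` have been merged. -/
def mergePoly {R : Type*} [CommRing R] (x y : V → R) (L L' : Finset V) :
    List V → (Finset V → R) → (Finset V → R) → R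
  | [], f, g => affinePoly f x L * affinePoly g y L'
  | v :: K, f, g => x v * mergePoly x y L L' K f g + mergePoly x y L L' K (shift f v) g +
      mergePoly x y L L' K f (shift g v)

lemma mergePoly_congr {R : Type*} [CommRing R] {x x' y y' : V → R} {L L' : Finset V} :
    ∀ {K : List V} (f g : Finset V → R), (∀ v ∈ K, x v = x' v) → (∀ v ∈ L, x v = x' v) →
      (∀ v ∈ L', y v = y' v) → mergePoly x y L L' K f g = mergePoly x' y' L L' K f g
  | [], f, g, _, h2, h3 => by
    rw [mergePoly, mergePoly, affinePoly_congr (fun _ _ => rfl) h2,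
      affinePoly_congr (fun _ _ => rfl) h3]
  | v :: K, f, g, h1, h2, h3 => by
    have ih := fun f g => mergePoly_congr (K := K) f g
      (fun w hw => h1 w (List.mem_cons_of_mem v hw)) h2 h3
    rw [mergePoly, mergePoly, ih, ih, ih, h1 v List.mem_cons_self]

lemma mergePoly_insert {R : Type*} [CommRing R] (x y : V → R) {L L' : Finset V} {v : V}
    (hL : v ∉ L) (hL' : v ∉ L') :
    ∀ (K : List V) (f g : Finset V → R),
      mergePoly x y (insert v L) (insert v L') K f g =
        mergePoly x y L L' K f g * x v * y v + mergePoly x y L L' K f (shift g v) * x v +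
        mergePoly x y L L' K (shift f v) g * y v + mergePoly x y L L' K (shift f v) (shift g v)
  | [], f, g => by
    simp only [mergePoly]
    rw [affinePoly_insert f x hL, affinePoly_insert g y hL']
    ring
  | u :: K, f, g => by
    simp only [mergePoly, mergePoly_insert x y hL hL' K, shift_comm _ v u]
    ring

lemma mergePoly_empty {R : Type*} [CommRing R] (x y : V → R) :
    ∀ (K : List V) (f g : Finset V → R), K.Nodup →
      mergePoly x y ∅ ∅ K f g = affinePoly (setConv f g) x K.toFinset
  | [], f, g, _ => by simp [mergePoly, affinePoly_empty, setConv]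
  | v :: K, f, g, h => by
    have hv : v ∉ K.toFinset := fun h' => (List.nodup_cons.1 h).1 (List.mem_toFinset.1 h')
    have hK := (List.nodup_cons.1 h).2
    rw [mergePoly, mergePoly_empty x y K _ _ hK, mergePoly_empty x y K _ _ hK,
      mergePoly_empty x y K _ _ hK, List.toFinset_cons, affinePoly_insert _ _ hv, add_assoc]
    congr 1
    rw [affinePoly_congr (f := shift (setConv f g) v)
      (g := fun T => setConv (shift f v) g T + setConv f (shift g v) T)
      (fun T hT => shift_setConv f g fun h => hv (hT h)) (fun _ _ => rfl)]
    simp only [affinePoly, ← sum_add_distrib, add_mul]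

/-- Otherwise the quadratic obtained at `s = t` has root sum `ξ`, so one of its roots `ξ / 2 ± w`
lies in the upper half plane, against `h`. -/
lemma merge_ne_zero {a b c d ξ : ℂ} (ha : a ≠ 0) (hξ : 0 < ξ.im)
    (h : ∀ s t : ℂ, 0 < s.im → 0 < t.im → a * s * t + b * s + c * t + d ≠ 0) :
    ξ * a + c + b ≠ 0 := by
  intro h0
  obtain ⟨w, hw⟩ := IsAlgClosed.exists_pow_nat_eq (ξ ^ 2 / 4 - d / a) (n := 2) (by norm_num)
  have key : ∀ w : ℂ, w ^ 2 = ξ ^ 2 / 4 - d / a → 0 ≤ w.im → False := by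
    intro w hw hwi
    have him : 0 < (ξ / 2 + w).im := by
      rw [Complex.add_im, Complex.div_ofNat_im]
      linarith [half_pos hξ]
    apply h _ _ him him
    have hd : d = a * (ξ ^ 2 / 4 - w ^ 2) := by
      rw [hw]
      field_simp
      ring
    rw [hd]
    linear_combination (ξ / 2 + w) * h0
  rcases le_total 0 w.im with h1 | h1
  · exact key w hw h1
  · exact key (-w) (by rw [neg_sq, hw]) (by simpa using h1)

/-- A multiaffine polynomial is stable if neither it nor any of its specializations to a smaller
set of vertices vanishes when all variables are in the upper half plane. -/
def Stable (f : Finset V → ℂ) : Prop :=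
  ∀ (S : Finset V) (x : V → ℂ), (∀ v, 0 < (x v).im) → affinePoly f x S ≠ 0

/-- Before `v` is merged it takes independent values `s` and `t` in the two factors; this is the
induction hypothesis with `v` moved into `L` and `L'`. Merging keeps the cases where `v` is covered
by neither factor or by exactly one, and `merge_ne_zero` applies. -/
lemma Stable.mergePoly_ne_zero {f g : Finset V → ℂ} (hf : Stable f) (hg : Stable g) :
    ∀ (K : List V), K.Nodup → ∀ (L L' : Finset V), (∀ v ∈ K, v ∉ L ∧ v ∉ L') →
      ∀ x y : V → ℂ, (∀ v, 0 < (x v).im) → (∀ v, 0 < (y v).im) → mergePoly x y L L' K f g ≠ 0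
  | [], _, L, L', _, x, y, hx, hy => mul_ne_zero (hf L x hx) (hg L' y hy)
  | v :: K, hK, L, L', hL, x, y, hx, hy => by
    rw [List.nodup_cons] at hK
    have hvL := hL v List.mem_cons_self
    have ih := hf.mergePoly_ne_zero hg K hK.2
    rw [mergePoly]
    refine merge_ne_zero (d := mergePoly x y L L' K (shift f v) (shift g v))
      (ih L L' (fun w hw => hL w (List.mem_cons_of_mem v hw)) x y hx hy) (hx v) fun s t hs ht => ?_
    have hne : ∀ w ∈ K, w ≠ v := fun w hw h => hK.1 (h ▸ hw)
    have hupd : ∀ f g, mergePoly x y L L' K f g =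
        mergePoly (Function.update x v s) (Function.update y v t) L L' K f g := by
      intro f g
      refine mergePoly_congr f g (fun w hw => ?_) (fun w hw => ?_) (fun w hw => ?_)
      · rw [Function.update_of_ne (hne w hw)]
      · rw [Function.update_of_ne (by rintro rfl; exact hvL.1 hw)]
      · rw [Function.update_of_ne (by rintro rfl; exact hvL.2 hw)]
    have := ih (insert v L) (insert v L') (fun w hw => by
      have := hL w (List.mem_cons_of_mem v hw)
      simp only [mem_insert, not_or]
      exact ⟨⟨hne w hw, this.1⟩, hne w hw, this.2⟩) (Function.update x v s)
      (Function.update y v t) (fun w => ?_) (fun w => ?_)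
    · rw [mergePoly_insert _ _ hvL.1 hvL.2, Function.update_self, Function.update_self] at this
      rwa [hupd, hupd, hupd, hupd]
    · by_cases h : w = v
      · subst h; simpa using hs
      · simpa [h] using hx w
    · by_cases h : w = v
      · subst h; simpa using ht
      · simpa [h] using hy w

lemma Stable.setConv {f g : Finset V → ℂ} (hf : Stable f) (hg : Stable g) :
    Stable (setConv f g) := by
  intro S x hx
  have := hf.mergePoly_ne_zero hg S.toList S.nodup_toList ∅ ∅ (by simp) x x hx hx
  rwa [mergePoly_empty _ _ _ _ _ S.nodup_toList, toList_toFinset] at this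

end merge

/-! ### Stability for one Hermitian matrix, through its resolvent. -/

section hermitian

variable {V : Type*} [DecidableEq V]

omit [DecidableEq V] in
-- Pairing the equation with `b` makes ∑ x_u |b_u|² equal to a Hermitian form, hence real; its
-- imaginary part is a sum of nonnegative terms with positive factors Im x_u.
lemma eq_zero_of_mem_kernel {a : Matrix V V ℂ} (ha : a.IsHermitian) {x : V → ℂ}
    (hx : ∀ v, 0 < (x v).im) {S : Finset V} {b : V → ℂ}
    (hb : ∀ u ∈ S, x u * b u = ∑ w ∈ S, a u w * b w) : ∀ u ∈ S, b u = 0 := by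
  have h1 : ∑ u ∈ S, x u * (Complex.normSq (b u) : ℂ) =
      ∑ u ∈ S, ∑ w ∈ S, star (b u) * (a u w * b w) := by
    refine sum_congr rfl fun u hu => ?_
    rw [← mul_sum, ← hb u hu, ← Complex.mul_conj]
    simp only [Complex.star_def]
    ring
  have h2 : star (∑ u ∈ S, ∑ w ∈ S, star (b u) * (a u w * b w)) =
      ∑ u ∈ S, ∑ w ∈ S, star (b u) * (a u w * b w) := by
    rw [star_sum, sum_congr rfl fun u _ => star_sum _ _, sum_comm]
    refine sum_congr rfl fun u _ => sum_congr rfl fun w _ => ?_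
    rw [star_mul', star_mul', star_star, ha.apply]
    ring
  have h3 := Complex.conj_eq_iff_im.1 h2
  rw [← h1, Complex.im_sum] at h3
  simp only [Complex.im_mul_ofReal] at h3
  rw [sum_eq_zero_iff_of_nonneg fun u _ => mul_nonneg (hx u).le (Complex.normSq_nonneg _)] at h3
  intro u hu
  rcases mul_eq_zero.1 (h3 u hu) with h | h
  · exact absurd h (hx u).ne'
  · exact Complex.normSq_eq_zero.1 h

lemma exists_resolvent_column {a : Matrix V V ℂ} (ha : a.IsHermitian) {x : V → ℂ}
    (hx : ∀ v, 0 < (x v).im) (S : Finset V) (c : V → ℂ) :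
    ∃ b : V → ℂ, ∀ u ∈ S, x u * b u - ∑ w ∈ S, a u w * b w = c u := by
  let T : (S → ℂ) →ₗ[ℂ] (S → ℂ) :=
    (Matrix.of fun u w : S => (if u = w then x u else 0) - a u w).mulVecLin
  have hT : ∀ (b : V → ℂ) (u : S), T (fun w => b w) u = x u * b u - ∑ w ∈ S, a u w * b w := by
    intro b u
    simp only [T, Matrix.mulVecLin_apply, Matrix.mulVec, dotProduct, Matrix.of_apply, sub_mul,
      sum_sub_distrib, ite_mul, zero_mul, sum_ite_eq, mem_univ, if_true]
    congr 1
    exact sum_coe_sort S fun w => a u w * b w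
  have hext : ∀ b : S → ℂ, ∃ b' : V → ℂ, (fun w : S => b' w) = b := fun b =>
    ⟨fun v => if h : v ∈ S then b ⟨v, h⟩ else 0, by funext w; simp⟩
  have hinj : Function.Injective T := by
    rw [injective_iff_map_eq_zero]
    intro b hb
    obtain ⟨b', rfl⟩ := hext b
    funext u
    refine eq_zero_of_mem_kernel ha hx (S := S) (b := b') (fun u hu => ?_) u u.2
    have := congrFun hb ⟨u, hu⟩
    rw [hT] at this
    exact sub_eq_zero.1 this
  obtain ⟨b, hb⟩ := (LinearMap.injective_iff_surjective.1 hinj) fun u => c u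
  obtain ⟨b', rfl⟩ := hext b
  exact ⟨b', fun u hu => by rw [← hT b' ⟨u, hu⟩, hb]⟩

variable [Fintype V]

/-- A function on vertex sets that obeys the deletion recursion of a Hermitian matrix is a minor
of the resolvent, hence does not vanish in the upper half plane. -/
lemma ne_zero_of_pathSum {a : Matrix V V ℂ} (ha : a.IsHermitian) {x : V → ℂ}
    (hx : ∀ v, 0 < (x v).im) {φ : Finset V → ℂ} (h0 : φ ∅ ≠ 0)
    (hφ : ∀ S, ∀ u ∈ S, φ S = x u * φ (S.erase u) - pathSum a φ S u u) (S : Finset V) :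
    φ S ≠ 0 ∧ ∀ (t : V) (b : V → ℂ), (∀ u ∈ S, x u * b u - ∑ w ∈ S, a u w * b w = a u t) →
      ∀ u ∈ S, φ S * b u = pathSum a φ S u t := by
  induction S using Finset.strongInduction with
  | H S ih =>
    -- The second factor is the Schur complement of the block `S.erase u`.
    have step : ∀ u ∈ S, ∃ c : V → ℂ, (∀ w ∈ S.erase u, x w * c w -
        ∑ w' ∈ S.erase u, a w w' * c w' = a w u) ∧
        φ S = φ (S.erase u) * (x u - a u u - ∑ w ∈ S.erase u, a u w * c w) := by
      intro u hu
      obtain ⟨c, hc⟩ := exists_resolvent_column ha hx (S.erase u) fun w => a w u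
      refine ⟨c, hc, ?_⟩
      have h := (ih _ (erase_ssubset hu)).2 u c hc
      have h' : ∑ w ∈ S.erase u, a u w * pathSum a φ (S.erase u) w u =
          φ (S.erase u) * ∑ w ∈ S.erase u, a u w * c w := by
        rw [mul_sum]
        exact sum_congr rfl fun w hw => by rw [← h w hw]; ring
      rw [hφ S u hu, pathSum_eq, h']
      ring
    constructor
    · rcases S.eq_empty_or_nonempty with rfl | ⟨u, hu⟩
      · exact h0
      obtain ⟨c, hc, hS⟩ := step u hu
      rw [hS]
      refine mul_ne_zero (ih _ (erase_ssubset hu)).1 fun hs => ?_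
      have hcu : ∀ w ∈ S.erase u, Function.update c u 1 w = c w := fun w hw =>
        Function.update_of_ne (ne_of_mem_erase hw) _ _
      have hsum : ∀ v, ∑ w ∈ S, a v w * Function.update c u 1 w =
          a v u + ∑ w ∈ S.erase u, a v w * c w := by
        intro v
        rw [← add_sum_erase S _ hu, Function.update_self, mul_one]
        congr 1
        exact sum_congr rfl fun w hw => by rw [hcu w hw]
      -- If the Schur complement vanished, `c` extended by 1 at `u` would be a nonzero kernel
      -- vector.
      have := eq_zero_of_mem_kernel ha hx (S := S) (b := Function.update c u 1) (fun v hv => ?_) u hu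
      · simp at this
      · rw [hsum]
        by_cases h : v = u
        · subst h
          rw [Function.update_self]
          linear_combination hs
        · have hv' := mem_erase.2 ⟨h, hv⟩
          rw [hcu v hv']
          linear_combination hc v hv'
    · intro t b hb u hu
      obtain ⟨c, hc, hS⟩ := step u hu
      -- Subtracting `b u` times the column `c` eliminates the unknown at `u`.
      have he := (ih _ (erase_ssubset hu)).2 t (fun w => b w - c w * b u) (fun w hw => by
        have h1 := hb w (mem_of_mem_erase hw)
        rw [← add_sum_erase S _ hu] at h1
        simp only [mul_sub, sum_sub_distrib]
        have h2 : ∑ w' ∈ S.erase u, a w w' * (c w' * b u) =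
            (∑ w' ∈ S.erase u, a w w' * c w') * b u := by
          rw [sum_mul]
          exact sum_congr rfl fun _ _ => by ring
        rw [h2]
        linear_combination h1 - b u * hc w hw)
      have h' : ∑ w ∈ S.erase u, a u w * pathSum a φ (S.erase u) w t =
          φ (S.erase u) * (∑ w ∈ S.erase u, a u w * b w -
            (∑ w ∈ S.erase u, a u w * c w) * b u) := by
        rw [sum_mul, ← sum_sub_distrib, mul_sum]
        exact sum_congr rfl fun w hw => by rw [← he w hw]; ring
      have hbu := hb u hu
      rw [← add_sum_erase S _ hu] at hbu
      rw [pathSum_eq, h', hS]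
      linear_combination φ (S.erase u) * hbu

end hermitian

/-! ### Several colors, and real-rootedness. -/

section colors

variable {V ι : Type*} [Fintype V] [DecidableEq V] [Fintype ι]

lemma pathSum_zero {R : Type*} [CommRing R] (φ : Finset V → R) (S : Finset V) (u t : V) :
    pathSum 0 φ S u t = 0 := by
  rw [pathSum_eq]
  simp

lemma stable_cycleCover_of_eq_zero {A : ι → Matrix V V ℂ} {j : ι} (hj : (A j).IsHermitian)
    (hA : ∀ i ≠ j, A i = 0) : Stable (cycleCover A) := by
  intro S x hx
  refine (ne_zero_of_pathSum hj hx (φ := affinePoly (cycleCover A) x) ?_ (fun S u hu => ?_) S).1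
  · rw [affinePoly_empty, cycleCover_empty]
    exact one_ne_zero
  · rw [affinePoly_cycleCover A x hu, sum_eq_single j (fun i _ hi => by rw [hA i hi, pathSum_zero])
      (fun h => absurd (mem_univ j) h)]

lemma stable_cycleCover_zero : Stable (cycleCover (0 : ι → Matrix V V ℂ)) := by
  intro S x hx
  refine (ne_zero_of_pathSum Matrix.isHermitian_zero hx
    (φ := affinePoly (cycleCover (0 : ι → Matrix V V ℂ)) x) ?_ (fun S u hu => ?_) S).1
  · rw [affinePoly_empty, cycleCover_empty]
    exact one_ne_zero
  · rw [affinePoly_cycleCover _ x hu, pathSum_zero]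
    simp [pathSum_zero]

lemma stable_cycleCover [DecidableEq ι] {A : ι → Matrix V V ℂ} (hA : ∀ j, (A j).IsHermitian) :
    Stable (cycleCover A) := by
  have key : ∀ J : Finset ι, Stable (cycleCover fun j => if j ∈ J then A j else 0) := by
    intro J
    induction J using Finset.induction_on with
    | empty =>
      have : (fun j => if j ∈ (∅ : Finset ι) then A j else 0) = 0 := by
        funext j
        simp
      rw [this]
      exact stable_cycleCover_zero
    | insert j J hj ih =>
      have h1 : Stable (cycleCover fun i => if i = j then A i else 0) :=
        stable_cycleCover_of_eq_zero (j := j) (by simpa using hA j) fun i hi => by simp [hi]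
      -- A cycle uses the matrix of its own color only, so at most one of the two weights is
      -- nonzero. Cycles are nonempty, so the zero matrix gives weight zero.
      have h2 : ColoredCycle.weight (fun i => if i ∈ insert j J then A i else 0) =
          ColoredCycle.weight (fun i => if i = j then A i else 0) +
            ColoredCycle.weight (fun i => if i ∈ J then A i else 0) := by
        funext γ
        have hz : ∏ v ∈ γ.verts, (0 : Matrix V V ℂ) v (γ.succ v) = 0 := by
          obtain ⟨v, hv⟩ := γ.verts_nonempty
          exact prod_eq_zero hv rfl
        simp only [ColoredCycle.weight, Pi.add_apply, mem_insert]
        by_cases h : γ.2 = j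
        · have h' : γ.2 ∉ J := h ▸ hj
          simp only [h, hj, if_true, if_false, hz, true_or, add_zero]
        · simp only [h, if_false, hz, false_or, zero_add]
      have h3 : (cycleCover fun i => if i ∈ insert j J then A i else 0) =
          setConv (cycleCover fun i => if i = j then A i else 0)
            (cycleCover fun i => if i ∈ J then A i else 0) := by
        funext W
        rw [cycleCover, h2, coverSum_add ColoredCycle.verts_nonempty]
        rfl
      rw [h3]
      exact h1.setConv ih
  simpa using key univ

lemma map_affinePoly_cycleCover {R R' : Type*} [CommRing R] [CommRing R'] (f : R →+* R')
    (A : ι → Matrix V V R) (x : V → R) (S : Finset V) :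
    f (affinePoly (cycleCover A) x S) =
      affinePoly (cycleCover fun j => (A j).map f) (fun v => f (x v)) S := by
  simp only [affinePoly, cycleCover, coverSum, ColoredCycle.weight, map_sum, map_mul, map_prod,
    map_neg, Matrix.map_apply]

lemma im_eq_zero_of_isRoot [DecidableEq ι] {A : ι → Matrix V V ℂ} (hA : ∀ j, (A j).IsHermitian)
    (hreal : ∀ j u v, star (A j u v) = A j u v) {z : ℂ} (hz : (additiveCharpoly A).IsRoot z) :
    z.im = 0 := by
  rw [Polynomial.IsRoot, eval_additiveCharpoly] at hz
  have hconj : affinePoly (cycleCover A) (fun _ => starRingEnd ℂ z) univ = 0 := by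
    have h := map_affinePoly_cycleCover (starRingEnd ℂ) A (fun _ => z) univ
    rw [hz, map_zero] at h
    rw [h]
    congr 2
    funext j
    ext u v
    exact (hreal j u v).symm
  rcases lt_trichotomy z.im 0 with h | h | h
  · exact absurd hconj (stable_cycleCover hA univ _ fun _ => by simpa using h)
  · exact h
  · exact absurd hz (stable_cycleCover hA univ _ fun _ => h)

end colors

end XRamanujan

namespace XRamanujan

open Finset PowerSeries

/-! ### Coefficientwise order on power series. -/

section coeffOrder

/-- Coefficientwise comparison of power series. -/
def CoeffLE (φ ψ : ℝ⟦X⟧) : Prop := ∀ n, coeff n φ ≤ coeff n ψ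

lemma CoeffLE.refl (φ : ℝ⟦X⟧) : CoeffLE φ φ := fun _ => le_rfl

lemma CoeffLE.trans {φ ψ χ : ℝ⟦X⟧} (h : CoeffLE φ ψ) (h' : CoeffLE ψ χ) : CoeffLE φ χ :=
  fun n => (h n).trans (h' n)

lemma CoeffLE.sum_nonneg {α : Type*} {I : Finset α} {f : α → ℝ⟦X⟧}
    (h : ∀ i ∈ I, CoeffLE 0 (f i)) : CoeffLE 0 (∑ i ∈ I, f i) := by
  intro n
  rw [map_zero, map_sum]
  exact Finset.sum_nonneg fun i hi => by simpa using h i hi n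

/-- By `hr` the chosen `x` determines its index, so the terms on the left inject into those on the
right. -/
lemma sum_coeffLE_of_exists {α β : Type*} {I : Finset α} {N : Finset β} {f : α → ℝ⟦X⟧}
    {g : β → ℝ⟦X⟧} (r : α → β → Prop) (hr : ∀ i ∈ I, ∀ i' ∈ I, ∀ x, r i x → r i' x → i = i')
    (h : ∀ i ∈ I, ∃ x ∈ N, r i x ∧ CoeffLE (f i) (g x)) (hg : ∀ x ∈ N, CoeffLE 0 (g x)) :
    CoeffLE (∑ i ∈ I, f i) (∑ x ∈ N, g x) := by
  classical
  rcases I.eq_empty_or_nonempty with rfl | ⟨i₀, hi₀⟩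
  · simpa using CoeffLE.sum_nonneg hg
  have : Nonempty β := ⟨(h i₀ hi₀).choose⟩
  choose! e he using h
  intro n
  rw [map_sum, map_sum]
  have hinj : Set.InjOn e I := fun i hi i' hi' hii' =>
    hr i hi i' hi' (e i) (he i hi).2.1 (hii' ▸ (he i' hi').2.1)
  calc ∑ i ∈ I, coeff n (f i) ≤ ∑ i ∈ I, coeff n (g (e i)) :=
        sum_le_sum fun i hi => (he i hi).2.2 n
    _ = ∑ x ∈ I.image e, coeff n (g x) := (sum_image (f := fun x => coeff n (g x)) hinj).symm
    _ ≤ ∑ x ∈ N, coeff n (g x) := by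
        refine sum_le_sum_of_subset_of_nonneg ?_ fun x hx _ => by simpa using hg x hx n
        intro x hx
        obtain ⟨i, hi, rfl⟩ := mem_image.1 hx
        exact (he i hi).1

/-- Solutions of affine fixed point equations are monotone in the coefficients. -/
lemma coeffLE_of_fixedPoint {β w L L' K K' : ℝ⟦X⟧} (hβ : β = L + X * K * β)
    (hw : w = L' + X * K' * w) (hL : CoeffLE 0 L) (hLL' : CoeffLE L L') (hK : CoeffLE 0 K)
    (hKK' : CoeffLE K K') : CoeffLE 0 β ∧ CoeffLE β w := by
  have key : ∀ n, 0 ≤ coeff n β ∧ coeff n β ≤ coeff n w := by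
    intro n
    induction n using Nat.strong_induction_on with
    | _ n ih =>
      rw [hβ, hw, mul_assoc, mul_assoc, map_add, map_add]
      have hL0 := hL n
      have hL1 := hLL' n
      rw [map_zero] at hL0
      cases n with
      | zero => simpa using ⟨by simpa using hL0, by simpa using hL1⟩
      | succ n =>
        rw [coeff_succ_X_mul, coeff_succ_X_mul, coeff_mul, coeff_mul]
        have h1 : ∀ p ∈ antidiagonal n, p.2 < n + 1 := fun p hp => by
          have := mem_antidiagonal.1 hp
          omega
        have hK0 : ∀ i, 0 ≤ coeff i K := fun i => by simpa using hK i
        refine ⟨add_nonneg hL0 (Finset.sum_nonneg fun p hp => mul_nonneg (hK0 _) (ih _ (h1 p hp)).1),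
          add_le_add hL1 (sum_le_sum fun p hp => ?_)⟩
        exact mul_le_mul (hKK' _) (ih _ (h1 p hp)).2 (ih _ (h1 p hp)).1 ((hK0 _).trans (hKK' _))
  exact ⟨fun n => by simpa using (key n).1, fun n => (key n).2⟩

end coeffOrder

/-! ### Generating functions of restricted walks. -/

section walks

variable {W : Type*} (G : SimpleGraph W) [G.LocallyFinite]

open Classical in
/-- The number of walks of a given length to `r` all of whose vertices but the last lie in `Y`. -/
noncomputable def walksWithin (Y : Set W) (r : W) : ℕ → W → ℝ
  | 0, s => if s = r then 1 else 0
  | k + 1, s => if s ∈ Y then ∑ s' ∈ G.neighborFinset s, walksWithin Y r k s' else 0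

/-- The generating function of `walksWithin`. -/
noncomputable def walkSeries (Y : Set W) (s r : W) : ℝ⟦X⟧ :=
  PowerSeries.mk fun k => walksWithin G Y r k s

variable {G}

lemma walkSeries_of_mem {Y : Set W} {s r : W} (hs : s ∈ Y) (hsr : s ≠ r) :
    walkSeries G Y s r = X * ∑ s' ∈ G.neighborFinset s, walkSeries G Y s' r := by
  ext n
  cases n with
  | zero => simp [walkSeries, walksWithin, hsr]
  | succ n => rw [coeff_succ_X_mul]; simp [walkSeries, walksWithin, hs]

lemma walkSeries_self {Y : Set W} {s : W} (hs : s ∈ Y) :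
    walkSeries G Y s s = 1 + X * ∑ s' ∈ G.neighborFinset s, walkSeries G Y s' s := by
  ext n
  cases n with
  | zero => simp [walkSeries, walksWithin]
  | succ n =>
    rw [map_add, coeff_succ_X_mul, coeff_one]
    simp [walkSeries, walksWithin, hs]

lemma walkSeries_of_notMem {Y : Set W} {s r : W} (hs : s ∉ Y) (hsr : s ≠ r) :
    walkSeries G Y s r = 0 := by
  ext n
  cases n with
  | zero => simp [walkSeries, walksWithin, hsr]
  | succ n => simp [walkSeries, walksWithin, hs]

lemma walkSeries_self_of_notMem {Y : Set W} {s : W} (hs : s ∉ Y) : walkSeries G Y s s = 1 := by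
  ext n
  cases n with
  | zero => simp [walkSeries, walksWithin]
  | succ n => simp [walkSeries, walksWithin, hs, coeff_one]

lemma walkSeries_nonneg (Y : Set W) (s r : W) : CoeffLE 0 (walkSeries G Y s r) := by
  have : ∀ n s, 0 ≤ walksWithin G Y r n s := by
    intro n
    induction n with
    | zero => intro s; rw [walksWithin]; split_ifs <;> norm_num
    | succ n ih =>
      intro s
      rw [walksWithin]
      split_ifs
      · exact Finset.sum_nonneg fun s' _ => ih s'
      · exact le_rfl
  intro n
  simpa [walkSeries] using this n s

lemma walkSeries_mono {Y Y' : Set W} (h : Y ⊆ Y') (s r : W) :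
    CoeffLE (walkSeries G Y s r) (walkSeries G Y' s r) := by
  have : ∀ n s, walksWithin G Y r n s ≤ walksWithin G Y' r n s := by
    intro n
    induction n with
    | zero => intro s; exact le_rfl
    | succ n ih =>
      intro s
      rw [walksWithin, walksWithin]
      by_cases hs : s ∈ Y
      · rw [if_pos hs, if_pos (h hs)]
        exact sum_le_sum fun s' _ => ih s'
      · rw [if_neg hs]
        split_ifs
        · exact Finset.sum_nonneg fun s' _ => by
            simpa [walkSeries] using walkSeries_nonneg (G := G) Y' s' r n
        · exact le_rfl
  intro n
  simpa [walkSeries] using this n s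

open Classical in
/-- Decomposition of walks at the first visit to `s`. -/
lemma walkSeries_eq_add {Y : Set W} {s : W} (hs : s ∈ Y) (r s' : W) :
    walkSeries G Y s' r = (if r = s then 0 else walkSeries G (Y \ {s}) s' r) +
      walkSeries G (Y \ {s}) s' s * walkSeries G Y s r := by
  ext n
  induction n using Nat.strong_induction_on generalizing s' with
  | _ n ih =>
    by_cases h1 : s' = s
    · subst h1
      rw [walkSeries_self_of_notMem (s := s') (Y := Y \ {s'}) (by simp), one_mul]
      by_cases h2 : r = s'
      · simp [h2]
      · rw [if_neg h2, walkSeries_of_notMem (s := s') (Y := Y \ {s'}) (by simp) (Ne.symm h2),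
          zero_add]
    by_cases h2 : s' ∈ Y
    · have h3 : s' ∈ Y \ {s} := ⟨h2, h1⟩
      have hstep : ∀ n, (∀ x, coeff n (walkSeries G Y x r) =
          coeff n ((if r = s then 0 else walkSeries G (Y \ {s}) x r) +
            walkSeries G (Y \ {s}) x s * walkSeries G Y s r)) →
          coeff (n + 1) (X * ∑ x ∈ G.neighborFinset s', walkSeries G Y x r) =
          coeff (n + 1) ((if r = s then 0 else
              X * ∑ x ∈ G.neighborFinset s', walkSeries G (Y \ {s}) x r) +
            X * (∑ x ∈ G.neighborFinset s', walkSeries G (Y \ {s}) x s) * walkSeries G Y s r) := by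
        intro n hn
        rw [coeff_succ_X_mul, map_add, mul_assoc, coeff_succ_X_mul, map_sum, sum_congr rfl
          fun x _ => hn x]
        simp only [map_add, sum_add_distrib, sum_mul, map_sum]
        congr 1
        by_cases h4 : r = s
        · simp [h4]
        · simp only [if_neg h4]
          rw [coeff_succ_X_mul, map_sum]
      rw [walkSeries_of_mem (Y := Y \ {s}) h3 h1]
      by_cases h4 : s' = r
      · subst h4
        rw [if_neg h1, walkSeries_self h2, walkSeries_self h3, add_assoc, map_add, map_add _ 1]
        congr 1
        cases n with
        | zero => simp
        | succ n => simpa only [if_neg h1] using hstep n fun x => ih n n.lt_succ_self x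
      · rw [walkSeries_of_mem h2 h4, walkSeries_of_mem h3 h4]
        cases n with
        | zero => split_ifs <;> simp
        | succ n => exact hstep n fun x => ih n n.lt_succ_self x
    · have h3 : s' ∉ Y \ {s} := fun h => h2 h.1
      rw [walkSeries_of_notMem h3 h1, zero_mul, add_zero]
      by_cases h4 : s' = r
      · subst h4
        rw [if_neg h1, walkSeries_self_of_notMem h2, walkSeries_self_of_notMem h3]
      · rw [walkSeries_of_notMem h2 h4, walkSeries_of_notMem h3 h4, ite_self]

end walks

/-! ### Heap polynomials as power series and their deletion ratios. -/

section heapSeries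

variable {V ι R : Type*} [Fintype V] [DecidableEq V] [Fintype ι] [CommRing R]
  (A : ι → SimpleGraph V) [∀ j, DecidableRel (A j).Adj]

/-- The signed generating function of the trivial heaps on `S`, where every arc has weight `y`. -/
noncomputable def heapSum (y : R) (S : Finset V) : R :=
  affinePoly (cycleCover fun j => y • (A j).adjMatrix R) (fun _ => 1) S

variable {A}

lemma heapSum_empty (y : R) : heapSum A y ∅ = 1 := by
  rw [heapSum, affinePoly_empty, cycleCover_empty]

lemma heapSum_eq (y : R) {S : Finset V} {u : V} (hu : u ∈ S) :
    heapSum A y S = heapSum A y (S.erase u) -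
      ∑ j, pathSum (y • (A j).adjMatrix R) (heapSum A y) S u u := by
  rw [heapSum, affinePoly_cycleCover _ _ hu, one_mul]
  rfl

lemma map_heapSum {R' : Type*} [CommRing R'] (f : R →+* R') (y : R) (S : Finset V) :
    f (heapSum A y S) = heapSum A (f y) S := by
  rw [heapSum, map_affinePoly_cycleCover, map_one, heapSum]
  congr 2
  funext j
  ext u v
  simp only [Matrix.map_apply, Matrix.smul_apply, SimpleGraph.adjMatrix_apply, smul_eq_mul,
    map_mul]
  split_ifs <;> simp

lemma heapSum_zero (S : Finset V) : heapSum A (0 : R) S = 1 := by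
  induction S using Finset.strongInduction with
  | H S ih =>
    rcases S.eq_empty_or_nonempty with rfl | ⟨u, hu⟩
    · exact heapSum_empty _
    · rw [heapSum_eq _ hu, ih _ (erase_ssubset hu)]
      simp [pathSum_zero]

/-- The generating function of self-avoiding paths of color `j` in `S` from `u` that leave `S`
through a final step to `t`, decorated with heaps. -/
noncomputable def pathRatio (A : ι → SimpleGraph V) [∀ j, DecidableRel (A j).Adj] (j : ι)
    (S : Finset V) (u t : V) : ℝ⟦X⟧ :=
  pathSum ((X : ℝ⟦X⟧) • (A j).adjMatrix ℝ⟦X⟧) (heapSum A (X : ℝ⟦X⟧)) S u t * (heapSum A (X : ℝ⟦X⟧) S)⁻¹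

lemma constantCoeff_heapSum_X (S : Finset V) :
    constantCoeff (R := ℝ) (heapSum A (X : ℝ⟦X⟧) S) = 1 := by
  rw [map_heapSum, constantCoeff_X, heapSum_zero]

lemma heapSum_X_ne_zero (S : Finset V) : heapSum A (X : ℝ⟦X⟧) S ≠ 0 := fun h => by
  have := constantCoeff_heapSum_X (A := A) S
  rw [h, map_zero] at this
  exact zero_ne_one this

lemma heapSum_mul_pathRatio (j : ι) (S : Finset V) (u t : V) :
    heapSum A (X : ℝ⟦X⟧) S * pathRatio A j S u t =
      pathSum ((X : ℝ⟦X⟧) • (A j).adjMatrix ℝ⟦X⟧) (heapSum A (X : ℝ⟦X⟧)) S u t := by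
  rw [pathRatio, mul_left_comm, PowerSeries.mul_inv_cancel _ (by
    rw [constantCoeff_heapSum_X]; exact one_ne_zero), mul_one]

/-- The sum over the decorated first returns to `u`, without the first step. -/
noncomputable def returnSum (A : ι → SimpleGraph V) [∀ j, DecidableRel (A j).Adj]
    (S : Finset V) (u : V) : ℝ⟦X⟧ :=
  ∑ p ∈ (univ ×ˢ S.erase u : Finset (ι × V)) with (A p.1).Adj u p.2,
    pathRatio A p.1 (S.erase u) p.2 u

lemma pathSum_X (j : ι) (S : Finset V) (u t : V) :
    pathSum ((X : ℝ⟦X⟧) • (A j).adjMatrix ℝ⟦X⟧) (heapSum A (X : ℝ⟦X⟧)) S u t = heapSum A (X : ℝ⟦X⟧) (S.erase u) *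
      (X * ((if (A j).Adj u t then 1 else 0) +
        ∑ u' ∈ S.erase u with (A j).Adj u u', pathRatio A j (S.erase u) u' t)) := by
  rw [pathSum_eq, sum_filter, mul_add, mul_add, mul_sum, mul_sum]
  congr 1
  · simp only [Matrix.smul_apply, SimpleGraph.adjMatrix_apply, smul_eq_mul]
    ring
  · refine sum_congr rfl fun u' _ => ?_
    rw [← heapSum_mul_pathRatio]
    simp only [Matrix.smul_apply, SimpleGraph.adjMatrix_apply, smul_eq_mul]
    split_ifs
    · ring
    · ring

/-- The atoms have no loops, so a return to `u` makes a first step to some other vertex; summing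
over that step gives `returnSum`. -/
lemma heapSum_X_eq {S : Finset V} {u : V} (hu : u ∈ S) :
    heapSum A (X : ℝ⟦X⟧) S = heapSum A (X : ℝ⟦X⟧) (S.erase u) * (1 - X * returnSum A S u) := by
  rw [heapSum_eq _ hu]
  simp only [pathSum_X, SimpleGraph.irrefl, if_false, zero_add]
  rw [← mul_sum, ← mul_sum, returnSum, sum_filter, sum_product]
  simp only [sum_filter]
  ring

/-- The first-step expansion is normalized by the heap sum on `S.erase u`, whereas `pathRatio`
divides by the one on `S`. The discrepancy is the last term, an excursion returning to `u`. -/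
lemma pathRatio_eq (j : ι) {S : Finset V} {u : V} (hu : u ∈ S) (t : V) :
    pathRatio A j S u t = X * ((if (A j).Adj u t then 1 else 0) +
        ∑ u' ∈ S.erase u with (A j).Adj u u', pathRatio A j (S.erase u) u' t) +
      X * returnSum A S u * pathRatio A j S u t := by
  have h := heapSum_mul_pathRatio (A := A) j S u t
  rw [pathSum_X, heapSum_X_eq hu, mul_assoc] at h
  have h' := mul_left_cancel₀ (heapSum_X_ne_zero _) h
  linear_combination h'

end heapSeries

end XRamanujan

namespace XRamanujan

open Finset PowerSeries

/-! ### Lifting decorated paths to walks in the additive product. -/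

section strings

variable {V ι : Type*} [DecidableEq V] [DecidableEq ι] {A : ι → SimpleGraph V} {v₁ : V}

/-- The string for the vertex `v` of the copy of the atom `j` attached to the end of `r`. -/
def node (v₁ : V) (r : List (ι × V)) (j : ι) (v : V) : List (ι × V) :=
  if v = lastVertex v₁ r then r else (j, v) :: r

/-- The string to which the copy of the atom `j` containing `s` is attached. -/
def copyRoot (s : List (ι × V)) (j : ι) : List (ι × V) :=
  match s with
  | [] => []
  | (i, v) :: r => if i = j then r else (i, v) :: r

omit [DecidableEq ι] in
lemma lastVertex_node (r : List (ι × V)) (j : ι) (v : V) :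
    lastVertex v₁ (node v₁ r j v) = v := by
  unfold node
  split_ifs with h
  · exact h.symm
  · rfl

omit [DecidableEq ι] in
lemma node_injective (r : List (ι × V)) (j : ι) : Function.Injective (node v₁ r j) :=
  fun v w h => by rw [← lastVertex_node (v₁ := v₁) r j v, h, lastVertex_node]

omit [DecidableEq ι] in
lemma isString_node {r : List (ι × V)} (hr : IsString A v₁ r) {j : ι}
    (hj : ∀ p ∈ r.head?, p.1 ≠ j) (hsupp : lastVertex v₁ r ∈ (A j).support) {v : V}
    (hv : v ∈ (A j).support) : IsString A v₁ (node v₁ r j v) := by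
  unfold node
  split_ifs with h
  · exact hr
  · exact ⟨hr, hj, hsupp, hv, Ne.symm h⟩

omit [DecidableEq V] in
lemma copyRoot_cases (s : List (ι × V)) (j : ι) :
    (copyRoot s j = s ∧ ∀ p ∈ s.head?, p.1 ≠ j) ∨
      ∃ v, s = (j, v) :: copyRoot s j := by
  match s with
  | [] => exact Or.inl ⟨rfl, by simp⟩
  | (i, v) :: r =>
    by_cases h : i = j
    · subst h
      exact Or.inr ⟨v, by simp [copyRoot]⟩
    · exact Or.inl ⟨by simp [copyRoot, h], by simpa using h⟩

omit [DecidableEq V] in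
lemma isString_copyRoot {s : List (ι × V)} (hs : IsString A v₁ s) (j : ι) :
    IsString A v₁ (copyRoot s j) := by
  rcases copyRoot_cases s j with ⟨h, -⟩ | ⟨v, h⟩
  · rwa [h]
  · rw [h] at hs
    exact hs.1

omit [DecidableEq V] in
lemma head_copyRoot {s : List (ι × V)} (hs : IsString A v₁ s) (j : ι) :
    ∀ p ∈ (copyRoot s j).head?, p.1 ≠ j := by
  rcases copyRoot_cases s j with ⟨h, h'⟩ | ⟨v, h⟩
  · rwa [h]
  · rw [h] at hs
    exact hs.2.1

lemma node_copyRoot {s : List (ι × V)} (hs : IsString A v₁ s) (j : ι) :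
    node v₁ (copyRoot s j) j (lastVertex v₁ s) = s := by
  rcases copyRoot_cases s j with ⟨h, -⟩ | ⟨v, h⟩
  · rw [h, node, if_pos rfl]
  · have hs' := hs
    rw [h] at hs'
    have hl : lastVertex v₁ s = v := by rw [h]; rfl
    rw [hl, node, if_neg hs'.2.2.2.2.symm, ← h]

omit [DecidableEq V] in
lemma lastVertex_copyRoot_mem_support {s : List (ι × V)} (hs : IsString A v₁ s) {j : ι}
    (h : lastVertex v₁ s ∈ (A j).support) : lastVertex v₁ (copyRoot s j) ∈ (A j).support := by
  rcases copyRoot_cases s j with ⟨h', -⟩ | ⟨v, h'⟩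
  · rwa [h']
  · rw [h'] at hs
    exact hs.2.2.1

omit [DecidableEq ι] in
lemma adj_of_node {r : List (ι × V)} {j : ι} {u v : V} (h : (A j).Adj u v)
    {p q : ProductVertex A v₁} (hp : p.1 = node v₁ r j u) (hq : q.1 = node v₁ r j v) :
    (additiveProduct A v₁).Adj p q := by
  unfold node at hp hq
  change IsSibling A p.1 q.1 ∨ IsExtension A v₁ p.1 q.1 ∨ IsExtension A v₁ q.1 p.1
  split_ifs at hp hq with h1 h2 h2
  · exact absurd (h1.trans h2.symm) h.ne
  · exact Or.inr (Or.inl ⟨j, v, by rw [hp, hq], by rwa [hp, ← h1]⟩)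
  · exact Or.inr (Or.inr ⟨j, u, by rw [hp, hq], by rw [hq, ← h2]; exact h.symm⟩)
  · exact Or.inl ⟨r, j, u, v, hp, hq, h⟩

/-- The strings that enter the copy of the atom `j` attached to `r` at a vertex of `S`. -/
def branch (A : ι → SimpleGraph V) (v₁ : V) (r : List (ι × V)) (j : ι) (S : Finset V) :
    Set (ProductVertex A v₁) :=
  {x | ∃ u ∈ S, (j, u) :: r <:+ x.1}

/-- Every edge of color `j` at the last vertex of a string `p` lifts to an edge of the product at
`p`. -/
lemma exists_neighbor (p : ProductVertex A v₁) {j : ι} {u' : V}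
    (h : (A j).Adj (lastVertex v₁ p.1) u') :
    ∃ x : ProductVertex A v₁, x.1 = node v₁ (copyRoot p.1 j) j u' ∧
      (additiveProduct A v₁).Adj p x := by
  have hu : lastVertex v₁ p.1 ∈ (A j).support := ⟨u', h⟩
  refine ⟨⟨node v₁ (copyRoot p.1 j) j u', isString_node (isString_copyRoot p.2 j)
    (head_copyRoot p.2 j) (lastVertex_copyRoot_mem_support p.2 hu) ⟨_, h.symm⟩⟩, rfl, ?_⟩
  exact adj_of_node h (node_copyRoot p.2 j).symm rfl

variable [Fintype V] [Fintype ι] [∀ j, DecidableRel (A j).Adj]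
  [(additiveProduct A v₁).LocallyFinite]

/-- The comparison of path sums in `S` with walks in the branches of the product over `S`. -/
def BranchBound (A : ι → SimpleGraph V) (v₁ : V) [∀ j, DecidableRel (A j).Adj]
    [(additiveProduct A v₁).LocallyFinite] (S : Finset V) : Prop :=
  ∀ (j : ι) (r : List (ι × V)), IsString A v₁ r → (∀ p ∈ r.head?, p.1 ≠ j) →
    lastVertex v₁ r ∉ S → ∀ u ∈ S, ∀ t ∉ S, ∀ p q : ProductVertex A v₁,
      p.1 = node v₁ r j u → q.1 = node v₁ r j t →
        CoeffLE 0 (pathRatio A j S u t) ∧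
          CoeffLE (pathRatio A j S u t)
            (walkSeries (additiveProduct A v₁) (branch A v₁ r j S) p q)

/-- The copy of an atom through `p` is attached at `p`, or at its parent for the last color of `p`.
By `hpar` the parent ends outside `S`, so the induction hypothesis applies to every color. -/
lemma returnSum_bound {S : Finset V} {u : V} (hS : BranchBound A v₁ (S.erase u))
    {p : ProductVertex A v₁} (hp : lastVertex v₁ p.1 = u)
    (hpar : ∀ j r, p.1 = (j, u) :: r → lastVertex v₁ r ∉ S) {Z : Set (ProductVertex A v₁)}
    (hZ : ∀ j, branch A v₁ (copyRoot p.1 j) j (S.erase u) ⊆ Z) :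
    CoeffLE 0 (returnSum A S u) ∧
      CoeffLE (returnSum A S u) (∑ x ∈ (additiveProduct A v₁).neighborFinset p,
        walkSeries (additiveProduct A v₁) Z x p) := by
  have hroot : ∀ j, lastVertex v₁ (copyRoot p.1 j) ∉ S.erase u := by
    intro j hj
    rcases copyRoot_cases p.1 j with ⟨h, -⟩ | ⟨v, h⟩
    · rw [h, hp] at hj
      exact notMem_erase u S hj
    · have hv : v = u := by rw [← hp, h]; rfl
      subst hv
      exact hpar j _ h (mem_of_mem_erase hj)
  have key : ∀ i ∈ (univ ×ˢ S.erase u : Finset (ι × V)).filter fun i => (A i.1).Adj u i.2,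
      ∃ x ∈ (additiveProduct A v₁).neighborFinset p, x.1 = i :: copyRoot p.1 i.1 ∧
        CoeffLE 0 (pathRatio A i.1 (S.erase u) i.2 u) ∧
        CoeffLE (pathRatio A i.1 (S.erase u) i.2 u)
          (walkSeries (additiveProduct A v₁) Z x p) := by
    rintro ⟨j, u'⟩ hi
    simp only [mem_filter, mem_product, mem_univ, true_and] at hi
    obtain ⟨x, hx, hadj⟩ := exists_neighbor p (hp.symm ▸ hi.2)
    have hx' : x.1 = (j, u') :: copyRoot p.1 j := by
      rw [hx, node, if_neg]
      rintro rfl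
      exact hroot j hi.1
    have hb := hS j (copyRoot p.1 j) (isString_copyRoot p.2 j) (head_copyRoot p.2 j) (hroot j) u'
      hi.1 u (notMem_erase u S) x p hx (by rw [← hp, node_copyRoot p.2 j])
    exact ⟨x, by simpa using hadj, hx', hb.1, hb.2.trans (walkSeries_mono (hZ j) x p)⟩
  refine ⟨CoeffLE.sum_nonneg fun i hi => (key i hi).choose_spec.2.2.1, ?_⟩
  refine sum_coeffLE_of_exists (fun i x => x.1 = i :: copyRoot p.1 i.1) ?_ ?_ fun x _ =>
    walkSeries_nonneg _ _ _
  · rintro i - i' - x h h'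
    exact (List.cons.inj (h.symm.trans h')).1
  · intro i hi
    obtain ⟨x, h1, h2, -, h3⟩ := key i hi
    exact ⟨x, h1, h2, h3⟩

/-- Path ratios from `u` and walks from `p` solve affine equations of the same shape, with visits to
`u` matched to visits to `p`. The inputs of the first equation live on `S.erase u`, and their lifts
stay in branches inside `Y \ {p}`, so induction compares the coefficients and
`coeffLE_of_fixedPoint` the solutions. -/
theorem branchBound (S : Finset V) : BranchBound A v₁ S := by
  classical
  induction S using Finset.strongInduction with
  | H S ih =>
    intro j r hr hj hrS u hu t ht p q hp hq
    have ihu := ih _ (erase_ssubset hu)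
    have hur : u ≠ lastVertex v₁ r := fun h => hrS (h ▸ hu)
    have hut : u ≠ t := fun h => ht (h ▸ hu)
    have hp' : p.1 = (j, u) :: r := by rw [hp, node, if_neg hur]
    have hlast : lastVertex v₁ p.1 = u := by rw [hp']; rfl
    have hpq : p ≠ q := fun h => hut (node_injective r j (by rw [← hp, ← hq, h]))
    have hpY : p ∈ branch A v₁ r j S := ⟨u, hu, hp' ▸ List.suffix_rfl⟩
    set Y := branch A v₁ r j S
    have hroot : copyRoot p.1 j = r := by rw [hp']; simp [copyRoot]
    have hlen : ∀ x : ProductVertex A v₁, ∀ i, (i :: p.1) <:+ x.1 → x ≠ p := by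
      rintro x i h rfl
      have := h.length_le
      simp at this
    have hsub : branch A v₁ r j (S.erase u) ⊆ Y \ {p} := by
      rintro x ⟨u', hu', hx⟩
      refine ⟨⟨u', mem_of_mem_erase hu', hx⟩, ?_⟩
      rintro rfl
      rw [hp'] at hx
      have := List.cons.inj (hx.eq_of_length (by simp))
      exact ne_of_mem_erase hu' (Prod.ext_iff.1 this.1).2
    have hret := returnSum_bound ihu hlast (fun i r' h => by
      rw [hp'] at h
      rwa [← (List.cons.inj h).2]) (Z := Y \ {p}) (fun i => by
        by_cases hij : i = j
        · subst hij
          rw [hroot]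
          exact hsub
        · have hc : copyRoot p.1 i = p.1 := by
            rw [hp']
            simp [copyRoot, Ne.symm hij]
          rw [hc]
          rintro x ⟨u', hu', hx⟩
          exact ⟨⟨u, hu, hp' ▸ (List.suffix_cons _ _).trans hx⟩, hlen x _ hx⟩)
    -- After its first step a walk either reaches `q` without meeting `p`, or returns to `p` and
    -- starts again.
    have hfix : walkSeries (additiveProduct A v₁) Y p q =
        X * ∑ x ∈ (additiveProduct A v₁).neighborFinset p,
          walkSeries (additiveProduct A v₁) (Y \ {p}) x q +
        X * (∑ x ∈ (additiveProduct A v₁).neighborFinset p,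
          walkSeries (additiveProduct A v₁) (Y \ {p}) x p) *
          walkSeries (additiveProduct A v₁) Y p q := by
      conv_lhs => rw [walkSeries_of_mem hpY hpq,
        sum_congr rfl fun x _ => walkSeries_eq_add hpY q x]
      rw [sum_add_distrib, mul_add, ← sum_mul, mul_assoc]
      simp only [if_neg hpq.symm]
    have hadjX : ∀ u' ∈ S.erase u, (A j).Adj u u' →
        ∃ x ∈ (additiveProduct A v₁).neighborFinset p, x.1 = node v₁ r j u' ∧
          CoeffLE 0 (pathRatio A j (S.erase u) u' t) ∧
          CoeffLE (pathRatio A j (S.erase u) u' t)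
            (walkSeries (additiveProduct A v₁) (Y \ {p}) x q) := by
      intro u' hu' h
      obtain ⟨x, hx, hadj⟩ := exists_neighbor p (hlast.symm ▸ h)
      rw [hroot] at hx
      have hb := ihu j r hr hj (fun h => hrS (mem_of_mem_erase h)) u' hu' t
        (fun h => ht (mem_of_mem_erase h)) x q hx hq
      exact ⟨x, by simpa using hadj, hx, hb.1, hb.2.trans (walkSeries_mono hsub x q)⟩
    -- The value 1 at `t` is the empty walk at `q`; it treats the final step on a par with the other
    -- first steps.
    set f : V → ℝ⟦X⟧ := fun u' => if u' = t then 1 else pathRatio A j (S.erase u) u' t with hf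
    have hsum : (if (A j).Adj u t then (1 : ℝ⟦X⟧) else 0) +
        ∑ u' ∈ S.erase u with (A j).Adj u u', pathRatio A j (S.erase u) u' t =
        ∑ u' ∈ insert t (S.erase u) with (A j).Adj u u', f u' := by
      have htS : t ∉ S.erase u := fun h => ht (mem_of_mem_erase h)
      rw [sum_filter, sum_filter, sum_insert htS]
      congr 1
      · simp [hf]
      · refine sum_congr rfl fun u' hu' => ?_
        have : u' ≠ t := by rintro rfl; exact htS hu'
        simp [hf, this]
    have hone : CoeffLE 0 (1 : ℝ⟦X⟧) := fun n => by
      rw [map_zero, coeff_one]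
      split_ifs <;> norm_num
    have hstep : ∀ u' ∈ (insert t (S.erase u)).filter fun u' => (A j).Adj u u',
        ∃ x ∈ (additiveProduct A v₁).neighborFinset p, x.1 = node v₁ r j u' ∧
          CoeffLE 0 (f u') ∧
          CoeffLE (f u') (walkSeries (additiveProduct A v₁) (Y \ {p}) x q) := by
      intro u' hu'
      rw [mem_filter, mem_insert] at hu'
      by_cases h : u' = t
      · subst h
        have hqY : q ∉ Y \ {p} := by
          rintro ⟨⟨w, hw, hsuf⟩, -⟩
          rw [hq, node] at hsuf
          split_ifs at hsuf
          · have := hsuf.length_le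
            simp at this
          · have hwu : w = u' :=
              (Prod.ext_iff.1 (List.cons.inj (hsuf.eq_of_length (by simp))).1).2
            exact ht (hwu ▸ hw)
        refine ⟨q, by simpa using adj_of_node hu'.2 hp hq, hq, ?_, ?_⟩
        · simpa [hf] using hone
        · rw [walkSeries_self_of_notMem hqY]
          simpa [hf] using CoeffLE.refl 1
      · have := hadjX u' (hu'.1.resolve_left h) hu'.2
        simpa only [hf, if_neg h] using this
    have hL0 := CoeffLE.sum_nonneg fun u' hu' => (hstep u' hu').choose_spec.2.2.1
    have hL1 := sum_coeffLE_of_exists (N := (additiveProduct A v₁).neighborFinset p)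
      (g := fun x => walkSeries (additiveProduct A v₁) (Y \ {p}) x q)
      (fun u' x => x.1 = node v₁ r j u')
      (fun a _ b _ x ha hb => node_injective r j (ha.symm.trans hb))
      (fun u' hu' => by
        obtain ⟨x, h1, h2, -, h3⟩ := hstep u' hu'
        exact ⟨x, h1, h2, h3⟩) fun x _ => walkSeries_nonneg _ _ _
    have hfix' := pathRatio_eq (A := A) j hu t
    rw [hsum] at hfix'
    refine coeffLE_of_fixedPoint hfix' hfix ?_ ?_ hret.1 hret.2
    · intro n
      cases n with
      | zero => simp
      | succ n => rw [coeff_succ_X_mul]; simpa using hL0 n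
    · intro n
      cases n with
      | zero => simp
      | succ n => rw [coeff_succ_X_mul, coeff_succ_X_mul]; exact hL1 n

/-- Deleting the vertex `u` changes the heap polynomial by a power series whose coefficients are
bounded by the numbers of closed walks in the product. -/
theorem exists_deletion_series {S : Finset V} {u : V} (hu : u ∈ S) {p : ProductVertex A v₁}
    (hp : lastVertex v₁ p.1 = u) (hpar : ∀ j r, p.1 = (j, u) :: r → lastVertex v₁ r ∉ S) :
    ∃ F : ℝ⟦X⟧, heapSum A (X : ℝ⟦X⟧) S * F = heapSum A (X : ℝ⟦X⟧) (S.erase u) ∧ CoeffLE 0 F ∧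
      CoeffLE F (walkSeries (additiveProduct A v₁) Set.univ p p) := by
  classical
  have hret := returnSum_bound (branchBound (S.erase u)) hp hpar (Z := Set.univ \ {p}) (fun j => by
    rintro x ⟨u', hu', hx⟩
    refine ⟨trivial, ?_⟩
    rintro rfl
    rcases copyRoot_cases x.1 j with ⟨h, -⟩ | ⟨v, h⟩
    · rw [h] at hx
      have := hx.length_le
      simp at this
    · have h2 : (j, u') :: copyRoot x.1 j = (j, v) :: copyRoot x.1 j := by
        rw [← h]
        refine hx.eq_of_length ?_
        conv_rhs => rw [h]
        simp
      have hv : v = u := by rw [← hp, h]; rfl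
      exact ne_of_mem_erase hu' ((Prod.ext_iff.1 (List.cons.inj h2).1).2.trans hv))
  have hunit : constantCoeff (1 - X * returnSum A S u) ≠ 0 := by simp
  -- `F` sums over sequences of decorated returns to `u`, as the closed-walk series sums over
  -- sequences of first returns to `p`.
  set F := (1 - X * returnSum A S u)⁻¹
  have hF : (1 - X * returnSum A S u) * F = 1 := PowerSeries.mul_inv_cancel _ hunit
  have hF' : F = 1 + X * returnSum A S u * F := by linear_combination hF
  have hW : walkSeries (additiveProduct A v₁) Set.univ p p =
      1 + X * (∑ x ∈ (additiveProduct A v₁).neighborFinset p,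
        walkSeries (additiveProduct A v₁) (Set.univ \ {p}) x p) *
        walkSeries (additiveProduct A v₁) Set.univ p p := by
    conv_lhs => rw [walkSeries_self (Set.mem_univ p),
      sum_congr rfl fun x _ => walkSeries_eq_add (Set.mem_univ p) p x]
    simp only [if_true, zero_add]
    rw [← sum_mul, mul_assoc]
  refine ⟨F, by rw [heapSum_X_eq hu, mul_assoc, hF, mul_one], ?_⟩
  refine coeffLE_of_fixedPoint hF' hW (fun n => ?_) (CoeffLE.refl 1) hret.1 hret.2
  rw [map_zero, coeff_one]
  split_ifs <;> norm_num

end strings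

end XRamanujan

namespace XRamanujan

open Finset Filter

/-! ### Walk counts and the spectral radius. -/

section counting

variable {W : Type*} (G : SimpleGraph W)

lemma walkCount_zero (s r : W) [Decidable (s = r)] : walkCount G s r 0 = if s = r then 1 else 0 := by
  unfold walkCount
  split_ifs with h
  · subst h
    rw [Nat.card_eq_one_iff_unique]
    refine ⟨⟨?_⟩, ⟨⟨SimpleGraph.Walk.nil, rfl⟩⟩⟩
    rintro ⟨p, hp⟩ ⟨q, hq⟩
    cases p with
    | nil =>
      cases q with
      | nil => rfl
      | cons _ _ => simp at hq
    | cons _ _ => simp at hp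
  · rw [Nat.card_eq_zero]
    left
    constructor
    rintro ⟨p, hp⟩
    exact h (SimpleGraph.Walk.eq_of_length_eq_zero hp)

variable [G.LocallyFinite]

lemma finite_walks (s r : W) (k : ℕ) : Finite {p : G.Walk s r // p.length = k} := by
  classical
  infer_instance

lemma walkCount_succ (s r : W) (k : ℕ) :
    walkCount G s r (k + 1) = ∑ s' ∈ G.neighborFinset s, walkCount G s' r k := by
  classical
  have := fun s' => finite_walks G s' r k
  let e : {p : G.Walk s r // p.length = k + 1} ≃
      (s' : G.neighborSet s) × {p : G.Walk s' r // p.length = k} :=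
    { toFun := fun p => match p with
        | ⟨.cons (v := v) h p, hp⟩ => ⟨⟨v, h⟩, ⟨p, by simpa using hp⟩⟩
      invFun := fun p => ⟨.cons ((G.mem_neighborSet s p.1.1).1 p.1.2) p.2.1,
        congrArg (· + 1) p.2.2⟩
      left_inv := by
        rintro ⟨p, hp⟩
        cases p with
        | nil => simp at hp
        | cons h p => rfl
      right_inv := by
        rintro ⟨⟨v, h⟩, ⟨p, hp⟩⟩
        rfl }
  rw [walkCount, Nat.card_congr e, Nat.card_sigma]
  exact Finset.sum_set_coe (f := fun s' => walkCount G s' r k) (G.neighborSet s)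

lemma walksWithin_univ (r : W) (k : ℕ) :
    ∀ s, walksWithin G Set.univ r k s = walkCount G s r k := by
  classical
  induction k with
  | zero => intro s; rw [walksWithin, walkCount_zero]; split_ifs <;> simp
  | succ k ih =>
    intro s
    rw [walksWithin, if_pos (Set.mem_univ s), walkCount_succ, Nat.cast_sum]
    exact sum_congr rfl fun s' _ => ih s'

lemma walkCount_comm {W : Type*} (G : SimpleGraph W) (s r : W) (k : ℕ) :
    walkCount G s r k = walkCount G r s k := by
  refine Nat.card_congr
    ⟨fun p => ⟨p.1.reverse, by simp [p.2]⟩, fun p => ⟨p.1.reverse, by simp [p.2]⟩, ?_, ?_⟩ <;>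
  · intro p
    simp

lemma exists_walkCount_le_add_left {s p : W} (h : G.Reachable s p) (r : W) :
    ∃ d, ∀ k, walkCount G s r k ≤ walkCount G p r (k + d) := by
  obtain ⟨w⟩ := h
  induction w with
  | nil => exact ⟨0, fun k => le_rfl⟩
  | @cons a b c hab w ih =>
    obtain ⟨d, hd⟩ := ih
    refine ⟨d + 1, fun k => ?_⟩
    calc walkCount G a r k ≤ ∑ s' ∈ G.neighborFinset b, walkCount G s' r k :=
          single_le_sum (f := fun s' => walkCount G s' r k) (fun _ _ => Nat.zero_le _)
            (by simpa using hab.symm)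
      _ = walkCount G b r (k + 1) := (walkCount_succ G b r k).symm
      _ ≤ walkCount G c r (k + 1 + d) := hd _
      _ = walkCount G c r (k + (d + 1)) := by congr 1; ring

/-- Extend both ends by fixed paths. The shift `d` does not depend on `k`, so the growth rate
between `p` and `q` controls closed walks at every `s`. -/
lemma exists_walkCount_le_add (hG : G.Preconnected) (s p q : W) :
    ∃ d, ∀ k, walkCount G s s k ≤ walkCount G p q (k + d) := by
  obtain ⟨d, hd⟩ := exists_walkCount_le_add_left G (hG s p) s
  obtain ⟨d', hd'⟩ := exists_walkCount_le_add_left G (hG s q) p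
  refine ⟨d + d', fun k => ?_⟩
  calc walkCount G s s k ≤ walkCount G p s (k + d) := hd k
    _ = walkCount G s p (k + d) := walkCount_comm G _ _ _
    _ ≤ walkCount G q p (k + d + d') := hd' _
    _ = walkCount G p q (k + (d + d')) := by rw [walkCount_comm, add_assoc]

lemma walkCount_le_pow {D : ℕ} (hD : ∀ s, (G.neighborFinset s).card ≤ D) (r : W) (k : ℕ) :
    ∀ s, walkCount G s r k ≤ D ^ k := by
  classical
  induction k with
  | zero => intro s; rw [walkCount_zero]; split_ifs <;> simp
  | succ k ih =>
    intro s
    rw [walkCount_succ, pow_succ']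
    calc ∑ s' ∈ G.neighborFinset s, walkCount G s' r k ≤ (G.neighborFinset s).card • D ^ k :=
          sum_le_card_nsmul _ _ _ fun s' _ => ih s'
      _ ≤ D * D ^ k := by rw [smul_eq_mul]; exact Nat.mul_le_mul_right _ (hD s)

/-- A real `limsup` is meaningful only for bounded sequences; the degree bound provides this. -/
lemma isBoundedUnder_walkCount {D : ℕ} (hD : ∀ s, (G.neighborFinset s).card ≤ D) (p q : W) :
    IsBoundedUnder (· ≤ ·) atTop
      (fun t : ℕ => (walkCount G p q t : ℝ) ^ (1 / (t : ℝ))) := by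
  refine isBoundedUnder_of_eventually_le (a := (D : ℝ)) ?_
  filter_upwards [eventually_gt_atTop 0] with t ht
  have h : (walkCount G p q t : ℝ) ≤ (D : ℝ) ^ t := by
    exact_mod_cast walkCount_le_pow G hD q t p
  calc (walkCount G p q t : ℝ) ^ (1 / (t : ℝ)) ≤ ((D : ℝ) ^ t) ^ (1 / (t : ℝ)) :=
        Real.rpow_le_rpow (Nat.cast_nonneg _) h (by positivity)
    _ = D := by
        rw [one_div, Real.pow_rpow_inv_natCast (Nat.cast_nonneg _) ht.ne']

lemma spectralRadius_nonneg {D : ℕ} (hD : ∀ s, (G.neighborFinset s).card ≤ D) (p q : W) :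
    0 ≤ spectralRadius G p q :=
  le_limsup_of_frequently_le (Frequently.of_forall fun t => by positivity)
    (isBoundedUnder_walkCount G hD p q)

lemma summable_walkCount {D : ℕ} (hD : ∀ s, (G.neighborFinset s).card ≤ D) (hG : G.Preconnected)
    (s p q : W) {y : ℝ} (hy : 0 < y) (h : spectralRadius G p q < y⁻¹) :
    Summable fun k => (walkCount G s s k : ℝ) * y ^ k := by
  -- The gap leaves room for a geometric majorant of ratio `ρ * y < 1`.
  obtain ⟨ρ, h1, h2⟩ := exists_between h
  have hρ : 0 < ρ := (spectralRadius_nonneg G hD p q).trans_lt h1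
  obtain ⟨d, hd⟩ := exists_walkCount_le_add G hG s p q
  have hev := eventually_lt_of_limsup_lt h1 (isBoundedUnder_walkCount G hD p q)
  have hρy : ρ * y < 1 := by
    rwa [← lt_div_iff₀ hy, one_div]
  have hsum : Summable fun k => ρ ^ d * (ρ * y) ^ k :=
    (summable_geometric_of_lt_one (by positivity) hρy).mul_left _
  refine summable_of_isBigO_nat hsum (Asymptotics.IsBigO.of_bound 1 ?_)
  filter_upwards [(tendsto_add_atTop_nat d).eventually hev, eventually_gt_atTop 0] with k hk hk0
  have hk' : (walkCount G p q (k + d) : ℝ) ≤ ρ ^ (k + d) := by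
    have h3 := pow_le_pow_left₀ (by positivity) hk.le (k + d)
    rwa [one_div, Real.rpow_inv_natCast_pow (Nat.cast_nonneg _) (by omega)] at h3
  rw [one_mul, Real.norm_of_nonneg (by positivity), Real.norm_of_nonneg (by positivity)]
  calc (walkCount G s s k : ℝ) * y ^ k ≤ ρ ^ (k + d) * y ^ k := by
        refine mul_le_mul_of_nonneg_right (le_trans ?_ hk') (by positivity)
        exact_mod_cast hd k
    _ = ρ ^ d * (ρ * y) ^ k := by ring

end counting

/-! ### Bounded degree, connectedness and strings in the product. -/

section product

variable {V ι : Type*} (A : ι → SimpleGraph V) (v₁ : V)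

lemma neighbor_cases {p q : ProductVertex A v₁} (h : (additiveProduct A v₁).Adj p q) :
    (∃ i, q.1 = i :: p.1.tail) ∨ (∃ i, q.1 = i :: p.1) ∨ q.1 = p.1.tail := by
  rcases h with ⟨r, c, u, v, hp, hq, -⟩ | ⟨c, v, h, -⟩ | ⟨c, v, h, -⟩
  · exact Or.inl ⟨(c, v), by rw [hp, hq]; rfl⟩
  · exact Or.inr (Or.inl ⟨(c, v), h⟩)
  · exact Or.inr (Or.inr (by rw [h]; rfl))

variable [Fintype V] [Fintype ι]

open Classical in
/-- A finite set of strings that contains all neighbors of a string. -/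
noncomputable def neighborCandidates (s : List (ι × V)) : Finset (List (ι × V)) :=
  univ.image (fun i => i :: s.tail) ∪ (univ.image (fun i => i :: s) ∪ {s.tail})

lemma mem_neighborCandidates {p q : ProductVertex A v₁} (h : (additiveProduct A v₁).Adj p q) :
    q.1 ∈ neighborCandidates p.1 := by
  simp only [neighborCandidates, mem_union, mem_image, mem_univ, true_and, mem_singleton]
  rcases neighbor_cases A v₁ h with ⟨i, h⟩ | ⟨i, h⟩ | h
  · exact Or.inl ⟨i, h.symm⟩
  · exact Or.inr (Or.inl ⟨i, h.symm⟩)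
  · exact Or.inr (Or.inr h)

lemma card_neighborCandidates (s : List (ι × V)) :
    (neighborCandidates s).card ≤ Fintype.card (ι × V) + (Fintype.card (ι × V) + 1) := by
  classical
  refine (card_union_le _ _).trans (Nat.add_le_add card_image_le ((card_union_le _ _).trans ?_))
  exact Nat.add_le_add card_image_le (by simp)

/-- The additive product of finitely many atoms is locally finite. -/
noncomputable instance locallyFiniteProduct : (additiveProduct A v₁).LocallyFinite := fun p =>
  Set.Finite.fintype (Set.Finite.of_finite_image
    ((neighborCandidates p.1).finite_toSet.subset (by
      rintro _ ⟨q, hq, rfl⟩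
      exact mem_neighborCandidates A v₁ hq)) Subtype.val_injective.injOn)

lemma card_neighborFinset_le (p : ProductVertex A v₁) :
    ((additiveProduct A v₁).neighborFinset p).card ≤
      Fintype.card (ι × V) + (Fintype.card (ι × V) + 1) := by
  classical
  refine le_trans ?_ (card_neighborCandidates p.1)
  refine card_le_card_of_injOn Subtype.val (fun q hq => ?_) Subtype.val_injective.injOn
  exact mem_neighborCandidates A v₁ (by simpa using hq)

variable {A v₁}

omit [Fintype V] [Fintype ι] in
-- The connected support of the atom `j` maps homomorphically onto the copy attached to `r`, which
-- joins `(j, v) :: r` to `r`; induct on the string.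
lemma preconnected_additiveProduct (hatom : ∀ j, ((A j).induce (A j).support).Connected) :
    (additiveProduct A v₁).Preconnected := by
  classical
  have key : ∀ s (hs : IsString A v₁ s),
      (additiveProduct A v₁).Reachable ⟨[], trivial⟩ ⟨s, hs⟩ := by
    intro s
    induction s with
    | nil => intro _; exact SimpleGraph.Reachable.refl _
    | cons i r ih =>
      obtain ⟨j, v⟩ := i
      intro hs
      refine (ih hs.1).trans ?_
      let f : (A j).induce (A j).support →g additiveProduct A v₁ :=
        { toFun := fun w => ⟨node v₁ r j w, isString_node hs.1 hs.2.1 hs.2.2.1 w.2⟩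
          map_rel' := fun {a b} hab => adj_of_node (r := r) (j := j) hab rfl rfl }
      have h := ((hatom j).preconnected ⟨_, hs.2.2.1⟩ ⟨v, hs.2.2.2.1⟩).map f
      have h1 : f ⟨_, hs.2.2.1⟩ = ⟨r, hs.1⟩ := Subtype.ext (if_pos rfl)
      have h2 : f ⟨v, hs.2.2.2.1⟩ = ⟨(j, v) :: r, hs⟩ := Subtype.ext (if_neg hs.2.2.2.2.symm)
      rwa [h1, h2] at h
  intro p q
  exact (key p.1 p.2).symm.trans (key q.1 q.2)

omit [Fintype V] [Fintype ι] in
/-- A string all of whose vertices lie in `D` can be prolonged along an edge that leaves `D`. -/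
lemma exists_string_of_adj {D : Finset V} (hv₁ : v₁ ∈ D) {s : List (ι × V)} (hs : IsString A v₁ s)
    (hsD : ∀ i ∈ s, i.2 ∈ D) {j : ι} {u : V} (hadj : (A j).Adj (lastVertex v₁ s) u) (hu : u ∉ D) :
    ∃ r, IsString A v₁ ((j, u) :: r) ∧ ∀ i ∈ r, i.2 ∈ D := by
  classical
  have hlast : ∀ r : List (ι × V), (∀ i ∈ r, i.2 ∈ D) → lastVertex v₁ r ∈ D := by
    intro r hr
    cases r with
    | nil => exact hv₁
    | cons i r => exact hr i List.mem_cons_self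
  have hrD : ∀ i ∈ copyRoot s j, i.2 ∈ D := by
    intro i hi
    rcases copyRoot_cases s j with ⟨h, -⟩ | ⟨v, h⟩
    · exact hsD i (h ▸ hi)
    · exact hsD i (h ▸ List.mem_cons_of_mem _ hi)
  refine ⟨copyRoot s j, ⟨isString_copyRoot hs j, head_copyRoot hs j,
    lastVertex_copyRoot_mem_support hs ⟨u, hadj⟩, ⟨_, hadj.symm⟩, ?_⟩, hrD⟩
  rintro rfl
  exact hu (hlast _ hrD)

end product

end XRamanujan

namespace XRamanujan

open Finset Filter

/-! ### Evaluation in the disk of convergence and deletion of all vertices. -/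

section evaluation

/-- If `F` converges absolutely at `y` and `P * F = Q`, then every zero `y` of the polynomial `P` is
a zero of `Q`. -/
lemma aeval_eq_zero_of_mul_eq {P Q : Polynomial ℝ} {F : PowerSeries ℝ}
    (h : (P : PowerSeries ℝ) * F = Q) {y : ℂ}
    (hF : Summable fun k => ‖PowerSeries.coeff k F‖ * ‖y‖ ^ k)
    (hP : Polynomial.aeval y P = 0) : Polynomial.aeval y Q = 0 := by
  have hpoly : ∀ R : Polynomial ℝ, ∀ k ∉ range (R.natDegree + 1), (R.coeff k : ℂ) * y ^ k = 0 := by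
    intro R k hk
    rw [R.coeff_eq_zero_of_natDegree_lt (by simpa [Nat.lt_succ_iff] using hk)]
    simp
  have heval : ∀ R : Polynomial ℝ, ∑' k, (R.coeff k : ℂ) * y ^ k = Polynomial.aeval y R := by
    intro R
    rw [tsum_eq_sum (hpoly R), Polynomial.aeval_eq_sum_range]
    exact sum_congr rfl fun k _ => by rw [Complex.real_smul]
  have hs1 : Summable fun k => ‖(P.coeff k : ℂ) * y ^ k‖ :=
    summable_of_ne_finset_zero (s := range (P.natDegree + 1)) fun k hk => by
      rw [hpoly P k hk, norm_zero]
  have hs2 : Summable fun k => ‖((PowerSeries.coeff k F : ℝ) : ℂ) * y ^ k‖ := by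
    simpa using hF
  have hprod := tsum_mul_tsum_eq_tsum_sum_antidiagonal_of_summable_norm hs1 hs2
  rw [heval, hP, zero_mul] at hprod
  rw [← heval, hprod]
  refine tsum_congr fun n => ?_
  have hn : Q.coeff n = ∑ p ∈ antidiagonal n, P.coeff p.1 * PowerSeries.coeff p.2 F := by
    rw [← Polynomial.coeff_coe, ← h, PowerSeries.coeff_mul]
    simp only [Polynomial.coeff_coe]
  rw [hn, Complex.ofReal_sum, sum_mul]
  refine sum_congr rfl fun p hp => ?_
  rw [← mem_antidiagonal.1 hp, Complex.ofReal_mul, pow_add]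
  ring

variable {V ι : Type*} [Fintype V] [DecidableEq V] [Fintype ι]

lemma cycleCover_smul {R : Type*} [CommRing R] (y : R) (B : ι → Matrix V V R) (W : Finset V) :
    cycleCover (fun j => y • B j) W = y ^ W.card * cycleCover B W := by
  rw [cycleCover, coverSum, cycleCover, coverSum, mul_sum]
  refine sum_congr rfl fun M hM => ?_
  rw [mem_exactCovers] at hM
  rw [← hM.2, card_biUnion hM.1, ← prod_pow_eq_pow_sum, ← prod_mul_distrib]
  refine prod_congr rfl fun γ _ => ?_
  simp only [ColoredCycle.weight, Matrix.smul_apply, smul_eq_mul, prod_mul_distrib, prod_const]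
  ring

variable {A : ι → SimpleGraph V} [∀ j, DecidableRel (A j).Adj]

/-- A heap covering `T` has `T.card` arcs, so `y = 1 / z` turns arc weights into the powers of `z`
on the uncovered vertices. -/
lemma heapSum_mul_pow {R : Type*} [CommRing R] {y z : R} (hyz : y * z = 1) (S : Finset V) :
    heapSum A y S * z ^ S.card =
      affinePoly (cycleCover fun j => (A j).adjMatrix R) (fun _ => z) S := by
  rw [heapSum, affinePoly, affinePoly, sum_mul]
  refine sum_congr rfl fun T hT => ?_
  rw [cycleCover_smul, prod_const_one, prod_const, ← card_sdiff_add_card_eq_card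
    (mem_powerset.1 hT), pow_add]
  have : y ^ T.card * z ^ T.card = 1 := by rw [← mul_pow, hyz, one_pow]
  linear_combination (cycleCover (fun j => (A j).adjMatrix R) T * z ^ (S \ T).card) * this

variable {v₁ : V}

/-- Zeros of the heap polynomial outside the spectral disk survive the deletion of a vertex. -/
lemma heapSum_erase_eq_zero {S : Finset V} {u : V} (hu : u ∈ S) {p : ProductVertex A v₁}
    (hp : lastVertex v₁ p.1 = u) (hpar : ∀ j r, p.1 = (j, u) :: r → lastVertex v₁ r ∉ S) {y : ℂ}
    (hy : Summable fun k => (walkCount (additiveProduct A v₁) p p k : ℝ) * ‖y‖ ^ k)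
    (h : heapSum A y S = 0) : heapSum A y (S.erase u) = 0 := by
  classical
  obtain ⟨F, hF, hF0, hF1⟩ := exists_deletion_series hu hp hpar
  -- One real polynomial specializes both to the power series `heapSum A X S` and to the complex
  -- number `heapSum A y S`.
  have hcoe : ∀ S, ((heapSum A (Polynomial.X : Polynomial ℝ) S : Polynomial ℝ) : PowerSeries ℝ) =
      heapSum A PowerSeries.X S := by
    intro S
    have := map_heapSum (A := A) (Polynomial.coeToPowerSeries.ringHom (R := ℝ)) Polynomial.X S
    simpa using this
  have haev : ∀ S, Polynomial.aeval y (heapSum A (Polynomial.X : Polynomial ℝ) S) =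
      heapSum A y S := by
    intro S
    have := map_heapSum (A := A) (Polynomial.aeval (R := ℝ) y).toRingHom Polynomial.X S
    simpa using this
  rw [← haev] at h ⊢
  refine aeval_eq_zero_of_mul_eq (by rw [hcoe, hcoe]; exact hF) ?_ h
  refine Summable.of_nonneg_of_le (fun k => by positivity) (fun k => ?_) hy
  refine mul_le_mul_of_nonneg_right ?_ (by positivity)
  have h0 := hF0 k
  rw [map_zero] at h0
  rw [Real.norm_of_nonneg h0, ← walksWithin_univ]
  simpa [walkSeries] using hF1 k

/-- Vertices of `S` are deleted one at a time. The invariant `hS` reaches each deleted vertex by a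
string that avoids `S`, which supplies the parent condition for the next deletion. -/
lemma heapSum_compl_ne_zero (hsum : (sumGraph A).Connected) {y : ℂ}
    (hy : ∀ p, Summable fun k => (walkCount (additiveProduct A v₁) p p k : ℝ) * ‖y‖ ^ k)
    (S : Finset V) (hv₁ : v₁ ∉ S)
    (hS : ∀ w ∉ S, ∃ s, IsString A v₁ s ∧ lastVertex v₁ s = w ∧ ∀ i ∈ s, i.2 ∉ S) :
    heapSum A y S ≠ 0 := by
  classical
  induction S using Finset.strongInduction with
  | H S ih =>
    rcases S.eq_empty_or_nonempty with rfl | ⟨u₀, hu₀⟩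
    · rw [heapSum_empty]
      exact one_ne_zero
    obtain ⟨w⟩ := hsum.preconnected v₁ u₀
    -- Connectedness of the sum graph gives an edge from a deleted vertex into `S`; its endpoint in
    -- `S` is deleted next.
    obtain ⟨d, -, hd1, hd2⟩ := w.exists_boundary_dart {v | v ∉ S} hv₁ (by simpa using hu₀)
    have hu : d.snd ∈ S := by simpa using hd2
    obtain ⟨j, hj⟩ := SimpleGraph.iSup_adj.1 d.adj
    obtain ⟨s, hs, hlast, hsS⟩ := hS d.fst hd1
    obtain ⟨r, hr, hrS⟩ := exists_string_of_adj (D := Sᶜ) (by simpa using hv₁) hs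
      (by simpa using hsS) (u := d.snd) (hlast.symm ▸ hj) (by simpa using hu)
    intro h0
    refine ih _ (erase_ssubset hu) (fun h => hv₁ (mem_of_mem_erase h)) (fun w hw => ?_)
      (heapSum_erase_eq_zero hu (p := ⟨(j, d.snd) :: r, hr⟩) rfl (fun j' r' h => ?_) (hy _) h0)
    · by_cases hwu : w = d.snd
      · refine ⟨(j, d.snd) :: r, hr, hwu.symm, fun i hi => ?_⟩
        rcases List.mem_cons.1 hi with rfl | hi
        · exact notMem_erase _ _
        · exact fun h => mem_compl.1 (hrS i hi) (mem_of_mem_erase h)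
      · obtain ⟨s, h1, h2, h3⟩ := hS w fun h => hw (mem_erase.2 ⟨hwu, h⟩)
        exact ⟨s, h1, h2, fun i hi h => h3 i hi (mem_of_mem_erase h)⟩
    · rw [← (List.cons.inj h).2]
      cases r with
      | nil => exact hv₁
      | cons i r => exact mem_compl.1 (hrS i List.mem_cons_self)

lemma heapSum_univ_ne_zero (hsum : (sumGraph A).Connected) {y : ℂ}
    (hy : ∀ p, Summable fun k => (walkCount (additiveProduct A v₁) p p k : ℝ) * ‖y‖ ^ k) :
    heapSum A y univ ≠ 0 := by
  intro h
  refine heapSum_compl_ne_zero hsum hy (univ.erase v₁) (notMem_erase _ _) (fun w hw => ?_)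
    -- The root `v₁` is deleted first: the empty string ends there and has no parent.
    (heapSum_erase_eq_zero (mem_univ v₁) (p := ⟨[], trivial⟩) rfl (fun j r h => ?_) (hy _) h)
  · exact ⟨[], trivial, (by simpa [eq_comm] using hw : v₁ = w), by simp⟩
  · simp at h

/-- The roots of the additive characteristic polynomial are bounded by the spectral radius of the
additive product. -/
theorem norm_le_spectralRadius [DecidableEq ι] (hsum : (sumGraph A).Connected)
    (hatom : ∀ j, ((A j).induce (A j).support).Connected) (p q : ProductVertex A v₁) {z : ℂ}
    (hz : (additiveCharpoly fun j => (A j).adjMatrix ℂ).IsRoot z) :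
    ‖z‖ ≤ spectralRadius (additiveProduct A v₁) p q := by
  have hD := card_neighborFinset_le A v₁
  by_contra! hlt
  have hpos : 0 < ‖z‖ := (spectralRadius_nonneg _ hD p q).trans_lt hlt
  have hz0 : z ≠ 0 := norm_pos_iff.1 hpos
  refine heapSum_univ_ne_zero (A := A) (v₁ := v₁) (y := z⁻¹) hsum (fun s => ?_) ?_
  · rw [norm_inv]
    exact summable_walkCount _ hD (preconnected_additiveProduct hatom) s p q (inv_pos.2 hpos)
      (by rwa [inv_inv])
  · rw [Polynomial.IsRoot, eval_additiveCharpoly, ← heapSum_mul_pow (inv_mul_cancel₀ hz0)] at hz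
    exact (mul_eq_zero.1 hz).resolve_right (pow_ne_zero _ hz0)

end evaluation

end XRamanujan

theorem mainTheorem3 {V ι : Type*} [Fintype V] [DecidableEq V] [Fintype ι] [DecidableEq ι]
    (A : ι → SimpleGraph V) [∀ j, DecidableRel (A j).Adj]
    (hsum : (XRamanujan.sumGraph A).Connected)
    (hatom : ∀ j, ((A j).induce (A j).support).Connected)
    (v₁ : V) (p q : XRamanujan.ProductVertex A v₁) (z : ℂ)
    (hz : (XRamanujan.additiveCharpoly fun j => (A j).adjMatrix ℂ).IsRoot z) :
    ∃ x ∈ Set.Icc (-XRamanujan.spectralRadius (XRamanujan.additiveProduct A v₁) p q)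
        (XRamanujan.spectralRadius (XRamanujan.additiveProduct A v₁) p q), z = (x : ℂ) := by
  have hstar : ∀ j u v, star ((A j).adjMatrix ℂ u v) = (A j).adjMatrix ℂ u v := by
    intro j u v
    rw [SimpleGraph.adjMatrix_apply]
    split_ifs <;> simp
  have him : z.im = 0 := XRamanujan.im_eq_zero_of_isRoot (A := fun j => (A j).adjMatrix ℂ)
    (fun j => Matrix.IsHermitian.ext fun u v => by
      rw [hstar]; simp only [SimpleGraph.adjMatrix_apply, SimpleGraph.adj_comm])
    hstar hz
  have hx : z = (z.re : ℂ) := Complex.ext rfl (by simpa using him)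
  refine ⟨z.re, abs_le.1 ?_, hx⟩
  exact (Complex.abs_re_le_norm z).trans (XRamanujan.norm_le_spectralRadius hsum hatom p q hz)
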